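/- Let $d\ge 0$, let $K\subset\mathbb R^d$ be compact, and let $F$ be a finite-dimensional real normed space (for example $F=\mathbb R$ or $F=\mathbb R^k$). Let $f:K\to F$ be a $C^1$ function on $K$ with derivative $f'$; that is, $f':K\to L(\mathbb R^d,F)$ is continuous and for every $x\in K$ one has $f(y)=f(x)+f'(x)(y-x)+o(|y-x|)$ as $y\to x$ with $y\in K$. (In particular, $f$ may be the restriction to $K$ of a $C^1$ function on an open neighbourhood of $K$, with $f'$ its usual derivative.) Let $\sigma$ be the ReLU activation $\sigma(t)=\max(t,0)$, or a leaky ReLU activation, $\sigma(t)=t$ for $t\ge 0$ and $\sigma(t)=\alpha t$ for $t<0$, with $0<\alpha<1$. Then for every $\varepsilon>0$ there is a neural network with a single hidden layer and activation $\sigma$, $$g(x)=\sum_{i=1}^m \sigma(\langle w_i,x\rangle+b_i)\,a_i+c,\qquad w_i\in\mathbb R^d,\ b_i\in\mathbb R,\ a_i,c\in F,$$ such that $g$ is differentiable at Lebesgue-almost every point of $\mathbb R^d$, and 1. $\|f(x)-g(x)\|<\varepsilon$ for every $x\in K$; 2. $\|f'(x)-Dg(x)\|<\varepsilon$ (operator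 norm) for every $x\in K$ at which $g$ is differentiable; 3. $g$ approximates $f$ up to $\varepsilon$ in the first order Sobolev norm on $K$: for every $p\in[1,\infty]$, $$\|f-g\|_{L^p(K)}+\|f'-Dg\|_{L^p(K)}<\varepsilon ,$$ where $L^p(K)$ is taken with respect to Lebesgue measure on $K$. -/

import Mathlib

open MeasureTheory
open scoped ENNReal

noncomputable section

/-- The ReLU activation `t ↦ max t 0`. -/
def relu (t : ℝ) : ℝ := max t 0

/-- The leaky ReLU activation with slope `α` on the negative half-line. -/
def leakyRelu (α t : ℝ) : ℝ := if 0 ≤ t then t else α * t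

/-- `σ` is the ReLU or a leaky ReLU (with some slope `0 < α < 1`). -/
def IsReluOrLeakyRelu (σ : ℝ → ℝ) : Prop :=
  σ = relu ∨ ∃ α : ℝ, 0 < α ∧ α < 1 ∧ σ = leakyRelu α

/-- The parameters of a neural network with inputs in `ℝ^d`, a single hidden layer of
`width` units, and a linear output layer with values in `F`
(`F = ℝ` for a scalar output, `F = ℝ^k` for `k` output units). -/
structure ShallowNet (d : ℕ) (F : Type*) where
  /-- number of hidden units -/
  width : ℕ
  /-- input weights of the hidden units -/
  weight : Fin width → EuclideanSpace ℝ (Fin d)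
  /-- biases of the hidden units -/
  bias : Fin width → ℝ
  /-- output weights of the hidden units -/
  out : Fin width → F
  /-- output bias -/
  outBias : F

/-- The function computed by the network with activation `σ`:
`x ↦ ∑ i, σ (⟪w i, x⟫ + b i) • a i + c`. -/
def ShallowNet.eval {d : ℕ} {F : Type*} [NormedAddCommGroup F] [NormedSpace ℝ F]
    (N : ShallowNet d F) (σ : ℝ → ℝ) (x : EuclideanSpace ℝ (Fin d)) : F :=
  ∑ i, σ (inner ℝ (N.weight i) x + N.bias i) • N.out i + N.outBias

/-- `f` is a `C^1` function on the set `K` with derivative `f'`: at every point of `K` it is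
differentiable along `K` with derivative `f' x`, and `f'` is continuous on `K`. (If `f` is `C^1`
on an open neighbourhood of `K` then this holds with `f'` the usual derivative.) -/
structure IsC1OnWith {d : ℕ} {F : Type*} [NormedAddCommGroup F] [NormedSpace ℝ F]
    (K : Set (EuclideanSpace ℝ (Fin d))) (f : EuclideanSpace ℝ (Fin d) → F)
    (f' : EuclideanSpace ℝ (Fin d) → EuclideanSpace ℝ (Fin d) →L[ℝ] F) : Prop where
  hasFDerivWithinAt : ∀ x ∈ K, HasFDerivWithinAt f (f' x) K x
  continuousOn : ContinuousOn f' K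

/-- The distance in the first order Sobolev space over `K` with exponent `p`, between functions
`f`, `g` with derivatives `f'`, `g'`: `‖f - g‖_{L^p(K)} + ‖f' - g'‖_{L^p(K)}`. -/
def sobolevDist {d : ℕ} {F : Type*} [NormedAddCommGroup F] [NormedSpace ℝ F]
    (p : ℝ≥0∞) (K : Set (EuclideanSpace ℝ (Fin d)))
    (f : EuclideanSpace ℝ (Fin d) → F)
    (f' : EuclideanSpace ℝ (Fin d) → EuclideanSpace ℝ (Fin d) →L[ℝ] F)
    (g : EuclideanSpace ℝ (Fin d) → F)
    (g' : EuclideanSpace ℝ (Fin d) → EuclideanSpace ℝ (Fin d) →L[ℝ] F) : ℝ≥0∞ :=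
  eLpNorm (fun x => f x - g x) p (volume.restrict K) +
    eLpNorm (fun x => f' x - g' x) p (volume.restrict K)

end

/-!
For real-valued `f`, extend `f` and `f'` continuously from `K` to the whole space, and let `g y` be
the infimum, over the chains with short steps which start at `y`, of the value of `f` at the end
point, minus the Riemann sum of `f'` along the chain, plus a small multiple of the length of the
chain. Prepending a point to a chain shows that the increments of `g` near each point of `K` are
those of `f'` up to a small relative error. Moreover `g` is close to `f` on `K`: along chains of
small mesh close to `K` the fundamental theorem of calculus holds up to an error controlled by the
length, which is a compactness argument and only needs the differentiability of `f` along `K`.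

A Lipschitz and compactly supported modification of `g` is mollified. Replacing the mollifier by a
combination of the functions `x ↦ exp ⟪w, x⟫` changes the convolution, which is again such a
combination, by little in the Lipschitz seminorm, because the difference quotients of a Lipschitz
function are bounded. This reduces the problem to the exponential function on the line, whose
piecewise linear interpolants are combinations of ReLUs. A function which is close to `f` in this
sense has a derivative close to `f'` wherever it is differentiable.
-/

open Filter Topology Metric Asymptotics
open scoped NNReal

/-! ### Chains -/

section Chains

variable {X : Type*} [PseudoMetricSpace X] {U : Set X} {δ : ℝ} {x : ℕ → X}

/-- The length of the initial segment `x 0, …, x m` of a chain of points. -/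
def chainLength (x : ℕ → X) (m : ℕ) : ℝ := ∑ i ∈ Finset.range m, dist (x i) (x (i + 1))

/-- A chain of points of `U` with steps of size at most `δ`. Chains are infinite, so that the
number of steps which are used is a separate parameter; a finite chain is continued by a
constant one. -/
structure IsFineChain (U : Set X) (δ : ℝ) (x : ℕ → X) : Prop where
  mem : ∀ i, x i ∈ U
  dist_le : ∀ i, dist (x i) (x (i + 1)) ≤ δ

/-- `j` runs through the indices of the chain `x` in such a way that `t ↦ x (j t)` moves with
unit speed, up to an error `δ`. -/
structure IsUnitSpeed (x : ℕ → X) (δ : ℝ) (j : ℝ → ℕ) : Prop where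
  monotone : Monotone j
  chainLength_sub_le : ∀ s t, s ≤ t → chainLength x (j t) - chainLength x (j s) ≤ t - s + δ

@[simp]
lemma chainLength_zero (x : ℕ → X) : chainLength x 0 = 0 := by simp [chainLength]

lemma chainLength_succ (x : ℕ → X) (m : ℕ) :
    chainLength x (m + 1) = chainLength x m + dist (x m) (x (m + 1)) :=
  Finset.sum_range_succ _ _

lemma chainLength_succ' (x : ℕ → X) (m : ℕ) :
    chainLength x (m + 1) = dist (x 0) (x 1) + chainLength (fun i => x (i + 1)) m := by
  rw [chainLength, Finset.sum_range_succ', add_comm, chainLength]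

lemma chainLength_add (x : ℕ → X) (k m : ℕ) :
    chainLength x (k + m) = chainLength x k + chainLength (fun i => x (k + i)) m := by
  simp only [chainLength, Finset.sum_range_add, add_assoc]

lemma chainLength_mono (x : ℕ → X) : Monotone (chainLength x) :=
  monotone_nat_of_le_succ fun n => (chainLength_succ x n).ge.trans' (by simp)

lemma chainLength_nonneg (x : ℕ → X) (m : ℕ) : 0 ≤ chainLength x m :=
  Finset.sum_nonneg fun _ _ => dist_nonneg

lemma dist_le_chainLength_sub (x : ℕ → X) {a b : ℕ} (hab : a ≤ b) :
    dist (x a) (x b) ≤ chainLength x b - chainLength x a := by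
  rw [chainLength, chainLength, ← Finset.sum_Ico_eq_sub _ hab]
  exact dist_le_Ico_sum_dist x hab

namespace IsFineChain

lemma nonneg (hx : IsFineChain U δ x) : 0 ≤ δ := dist_nonneg.trans (hx.dist_le 0)

lemma mono {V : Set X} {δ' : ℝ} (hx : IsFineChain U δ x) (hUV : U ⊆ V) (hδ : δ ≤ δ') :
    IsFineChain V δ' x :=
  ⟨fun i => hUV (hx.mem i), fun i => (hx.dist_le i).trans hδ⟩

lemma const {y : X} (hy : y ∈ U) (hδ : 0 ≤ δ) : IsFineChain U δ fun _ => y :=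
  ⟨fun _ => hy, fun _ => by rwa [dist_self]⟩

lemma drop (hx : IsFineChain U δ x) (k : ℕ) : IsFineChain U δ fun i => x (k + i) :=
  ⟨fun i => hx.mem (k + i), fun i => hx.dist_le (k + i)⟩

lemma cons (hx : IsFineChain U δ x) {z : X} (hz : z ∈ U) (hzx : dist z (x 0) ≤ δ) :
    IsFineChain U δ fun i => i.casesOn z x :=
  ⟨Nat.rec hz fun i _ => hx.mem i, Nat.rec hzx fun i _ => hx.dist_le i⟩

lemma exists_isUnitSpeed (hx : IsFineChain U δ x) {m : ℕ} {T : ℝ} (hT : chainLength x m < T) :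
    ∃ j, IsUnitSpeed x δ j ∧ (∀ t, j t ≤ m) ∧ j 0 = 0 ∧ j T = m := by
  classical
  have hex (t : ℝ) : ∃ n, t ≤ chainLength x n ∨ m ≤ n := ⟨m, Or.inr le_rfl⟩
  let j (t : ℝ) : ℕ := Nat.find (hex t)
  have hjm (t : ℝ) : j t ≤ m := Nat.find_min' _ (Or.inr le_rfl)
  have hmono : Monotone j := fun s t hst =>
    Nat.find_min' _ ((Nat.find_spec (hex t)).imp_left hst.trans)
  refine ⟨j, ⟨hmono, fun s t hst => ?_⟩, hjm, ?_, (hjm T).antisymm ?_⟩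
  · rcases (hmono hst).eq_or_lt with heq | hlt
    · rw [heq, sub_self]
      linarith [hx.nonneg]
    have hs : s ≤ chainLength x (j s) :=
      (Nat.find_spec (hex s)).resolve_right (hlt.trans_le (hjm t)).not_ge
    obtain ⟨k, hk⟩ := Nat.exists_eq_add_one_of_ne_zero hlt.ne_bot
    have hkt : chainLength x k < t :=
      not_le.1 fun h => Nat.find_min (hex t) (k.lt_succ_self.trans_eq hk.symm) (Or.inl h)
    rw [hk, chainLength_succ]
    linarith [hx.dist_le k]
  · exact (Nat.find_eq_zero _).2 (Or.inl (chainLength_zero x).ge)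
  · exact (Nat.find_spec (hex T)).resolve_left fun h =>
      (hT.trans_le h).not_ge (chainLength_mono x (hjm T))

lemma exists_chainLength_mem_Icc (hx : IsFineChain U δ x) (hδ : δ ≤ 1) {m : ℕ}
    (hm : 1 ≤ chainLength x m) : ∃ k ≤ m, chainLength x k ∈ Set.Icc 1 2 := by
  classical
  have hex : ∃ n, 1 ≤ chainLength x n := ⟨m, hm⟩
  refine ⟨Nat.find hex, Nat.find_min' hex hm, Nat.find_spec hex, ?_⟩
  obtain ⟨n, hn⟩ := Nat.exists_eq_add_one_of_ne_zero (n := Nat.find hex) fun h0 => by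
    simpa [h0, not_le.2 one_pos] using Nat.find_spec hex
  have hlt := not_le.1 (Nat.find_min hex (n.lt_succ_self.trans_eq hn.symm))
  rw [hn, chainLength_succ]
  linarith [hx.dist_le n]

end IsFineChain

lemma IsUnitSpeed.dist_le {j : ℝ → ℕ} (hj : IsUnitSpeed x δ j) (s t : ℝ) :
    dist (x (j s)) (x (j t)) ≤ dist s t + δ := by
  wlog hst : s ≤ t generalizing s t
  · rw [dist_comm, dist_comm s]
    exact this t s (le_of_not_ge hst)
  rw [Real.dist_eq, abs_sub_comm, abs_of_nonneg (sub_nonneg.2 hst)]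
  exact (dist_le_chainLength_sub x (hj.monotone hst)).trans (hj.chainLength_sub_le s t hst)

end Chains

section ChainSums

variable {E F : Type*} [NormedAddCommGroup E] [NormedSpace ℝ E] [NormedAddCommGroup F]
  [NormedSpace ℝ F] {δ : ℝ} {x : ℕ → E} {A : E → E →L[ℝ] F} {Λ : E →L[ℝ] F} {C : ℝ}

/-- The Riemann sum of the one-form `A` along the initial segment `x 0, …, x m` of a chain. -/
def chainSum (A : E → E →L[ℝ] F) (x : ℕ → E) (m : ℕ) : F :=
  ∑ i ∈ Finset.range m, A (x i) (x (i + 1) - x i)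

@[simp]
lemma chainSum_zero (A : E → E →L[ℝ] F) (x : ℕ → E) : chainSum A x 0 = 0 := by simp [chainSum]

lemma chainSum_succ' (A : E → E →L[ℝ] F) (x : ℕ → E) (m : ℕ) :
    chainSum A x (m + 1) = A (x 0) (x 1 - x 0) + chainSum A (fun i => x (i + 1)) m := by
  rw [chainSum, Finset.sum_range_succ', add_comm, chainSum]

lemma chainSum_add (A : E → E →L[ℝ] F) (x : ℕ → E) (k m : ℕ) :
    chainSum A x (k + m) = chainSum A x k + chainSum A (fun i => x (k + i)) m := by
  simp only [chainSum, Finset.sum_range_add, add_assoc]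

lemma norm_chainSum_sub_sub_le {a b : ℕ} (hab : a ≤ b)
    (hA : ∀ i, a ≤ i → i < b → ‖A (x i) - Λ‖ ≤ C) :
    ‖chainSum A x b - chainSum A x a - Λ (x b - x a)‖
      ≤ C * (chainLength x b - chainLength x a) := by
  have hsum : chainSum A x b - chainSum A x a - Λ (x b - x a)
      = ∑ i ∈ Finset.Ico a b, (A (x i) - Λ) (x (i + 1) - x i) := by
    rw [chainSum, chainSum, ← Finset.sum_Ico_eq_sub _ hab, ← Finset.sum_Ico_sub x hab, map_sum,
      ← Finset.sum_sub_distrib]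
    simp only [sub_apply]
  rw [hsum, chainLength, chainLength, ← Finset.sum_Ico_eq_sub _ hab, Finset.mul_sum]
  refine norm_sum_le_of_le _ fun i hi => ?_
  obtain ⟨hai, hib⟩ := Finset.mem_Ico.1 hi
  rw [dist_eq_norm']
  exact (A (x i) - Λ).le_of_opNorm_le (hA i hai hib) _

lemma norm_chainSum_sub_le {a b : ℕ} (hab : a ≤ b) (hA : ∀ i, ‖A (x i)‖ ≤ C) :
    ‖chainSum A x b - chainSum A x a‖ ≤ C * (chainLength x b - chainLength x a) := by
  have h := norm_chainSum_sub_sub_le (A := A) (Λ := 0) hab fun i _ _ =>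
    (congrArg norm (sub_zero (A (x i)))).trans_le (hA i)
  rwa [zero_apply, sub_zero] at h

lemma norm_chainSum_le (hA : ∀ i, ‖A (x i)‖ ≤ C) (m : ℕ) :
    ‖chainSum A x m‖ ≤ C * chainLength x m := by
  simpa using norm_chainSum_sub_le m.zero_le hA

lemma IsUnitSpeed.dist_chainSum_le {j : ℝ → ℕ} (hj : IsUnitSpeed x δ j)
    (hA : ∀ i, ‖A (x i)‖ ≤ C) (s t : ℝ) :
    dist (chainSum A x (j s)) (chainSum A x (j t)) ≤ C * (dist s t + δ) := by
  wlog hst : s ≤ t generalizing s t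
  · rw [dist_comm, dist_comm s]
    exact this t s (le_of_not_ge hst)
  have hC : 0 ≤ C := (norm_nonneg _).trans (hA 0)
  rw [Real.dist_eq, abs_sub_comm, abs_of_nonneg (sub_nonneg.2 hst), dist_eq_norm']
  exact (norm_chainSum_sub_le (hj.monotone hst) hA).trans
    (mul_le_mul_of_nonneg_left (hj.chainLength_sub_le s t hst) hC)

end ChainSums

/-! ### The fundamental theorem of calculus along fine chains -/

section FundamentalTheorem

lemma exists_lipschitzWith_tendsto {ι T X : Type*} [PseudoMetricSpace T] [MetricSpace X]
    {𝒰 : Ultrafilter ι} {B : Set X} (hB : IsCompact B) {u : ι → T → X} (hu : ∀ i t, u i t ∈ B)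
    {δ : ι → ℝ} (hδ : Tendsto δ 𝒰 (𝓝 0)) {C : ℝ≥0}
    (hC : ∀ i s t, dist (u i s) (u i t) ≤ C * (dist s t + δ i)) :
    ∃ v : T → X, LipschitzWith C v ∧ ∀ t, Tendsto (fun i => u i t) 𝒰 (𝓝 (v t)) := by
  have hlim (t : T) : ∃ p ∈ B, Tendsto (fun i => u i t) 𝒰 (𝓝 p) :=
    hB.ultrafilter_le_nhds' (𝒰.map fun i => u i t)
      (mem_map.2 (univ_mem' fun i => hu i t))
  choose v _ hv using hlim
  refine ⟨v, LipschitzWith.of_dist_le_mul fun s t => ?_, hv⟩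
  have hdist : Tendsto (fun i => C * (dist s t + δ i)) 𝒰 (𝓝 (C * (dist s t + 0))) :=
    (hδ.const_add _).const_mul _
  rw [add_zero] at hdist
  exact le_of_tendsto_of_tendsto' ((hv s).dist (hv t)) hdist fun i => hC i s t

lemma mem_of_tendsto_of_mem_thickening {ι X : Type*} [PseudoMetricSpace X] {l : Filter ι} [l.NeBot]
    {K : Set X} (hK : IsClosed K) {δ : ι → ℝ} (hδ : Tendsto δ l (𝓝 0)) {y : ι → X}
    (hy : ∀ i, y i ∈ thickening (δ i) K) {p : X} (hp : Tendsto y l (𝓝 p)) : p ∈ K := by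
  choose q hqK hq using fun i => mem_thickening_iff.1 (hy i)
  have hqp : Tendsto q l (𝓝 p) := (tendsto_iff_of_dist
    (squeeze_zero (fun _ => dist_nonneg) (fun i => (hq i).le) hδ)).1 hp
  exact hK.mem_of_tendsto hqp (Eventually.of_forall hqK)

variable {E F : Type*} [NormedAddCommGroup E] [NormedSpace ℝ E] [NormedAddCommGroup F]
  [NormedSpace ℝ F] {K : Set E} {φ : E → F} {A : E → E →L[ℝ] F}

lemma comp_sub_comp_eq_of_isLittleO (hφ : Continuous φ)
    (hd : ∀ x ∈ K, HasFDerivWithinAt φ (A x) K x) {γ : ℝ → E} {C : ℝ≥0} (hγ : LipschitzWith C γ)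
    (hγK : ∀ t, γ t ∈ K) {S : ℝ → F} (hS : Continuous S)
    (hSγ : ∀ s, (fun t => S t - S s - A (γ s) (γ t - γ s)) =o[𝓝[≥] s] fun t => t - s)
    {a b : ℝ} (hab : a ≤ b) : φ (γ b) - φ (γ a) = S b - S a := by
  have hγO (s : ℝ) : (fun t => γ t - γ s) =O[𝓝[≥] s] fun t => t - s :=
    IsBigO.of_bound C (Eventually.of_forall fun t => hγ.norm_sub_le t s)
  have hγlim (s : ℝ) : Tendsto γ (𝓝[≥] s) (𝓝[K] (γ s)) :=
    tendsto_nhdsWithin_iff.2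
      ⟨hγ.continuous.continuousWithinAt, Eventually.of_forall hγK⟩
  have hderiv (s : ℝ) : HasDerivWithinAt (fun t => φ (γ t) - S t) 0 (Set.Ici s) s := by
    have hφγ : (fun t => φ (γ t) - φ (γ s) - A (γ s) (γ t - γ s)) =o[𝓝[≥] s] fun t => t - s :=
      ((hd (γ s) (hγK s)).isLittleO.comp_tendsto (hγlim s)).trans_isBigO (hγO s)
    refine hasDerivWithinAt_iff_isLittleO.2 ((hφγ.sub (hSγ s)).congr_left fun t => ?_)
    rw [smul_zero]
    abel
  have hconst := constant_of_has_deriv_right_zero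
    ((hφ.comp hγ.continuous).sub hS).continuousOn (fun s _ => hderiv s) b ⟨hab, le_rfl⟩
  simp only [Pi.sub_apply, Function.comp_apply] at hconst
  rw [sub_eq_sub_iff_sub_eq_sub]
  exact hconst

variable {ι : Type*} {𝒰 : Ultrafilter ι} {δ : ι → ℝ} {x : ι → ℕ → E} {j : ι → ℝ → ℕ} {C : ℝ≥0}

lemma isLittleO_of_tendsto_chainSum (hA : Continuous A) (hδ : Tendsto δ 𝒰 (𝓝 0))
    (hj : ∀ i, IsUnitSpeed (x i) (δ i) (j i))
    {γ : ℝ → E} (hγ : ∀ t, Tendsto (fun i => x i (j i t)) 𝒰 (𝓝 (γ t)))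
    {S : ℝ → F} (hS : ∀ t, Tendsto (fun i => chainSum A (x i) (j i t)) 𝒰 (𝓝 (S t))) (s : ℝ) :
    (fun t => S t - S s - A (γ s) (γ t - γ s)) =o[𝓝[≥] s] fun t => t - s := by
  refine isLittleO_iff.2 fun e he => ?_
  obtain ⟨ρ, hρ, hAρ⟩ := Metric.continuousAt_iff.1 (hA.continuousAt (x := γ s)) e he
  have hshort : ∀ᶠ t in 𝓝[≥] s, t < s + ρ :=
    mem_nhdsWithin_of_mem_nhds (gt_mem_nhds (lt_add_of_pos_right s hρ))
  filter_upwards [hshort, self_mem_nhdsWithin] with t ht hst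
  have hlen : Tendsto (fun i => e * (t - s + δ i)) 𝒰 (𝓝 (e * (t - s + 0))) :=
    (hδ.const_add _).const_mul _
  have hdist : Tendsto (fun i => t - s + δ i + dist (x i (j i s)) (γ s)) 𝒰
      (𝓝 (t - s + 0 + dist (γ s) (γ s))) := (hδ.const_add _).add ((hγ s).dist tendsto_const_nhds)
  rw [dist_self, add_zero, add_zero] at hdist
  rw [add_zero] at hlen
  rw [Real.norm_of_nonneg (sub_nonneg.2 hst)]
  refine le_of_tendsto_of_tendsto (((hS t).sub (hS s)).sub
    (((A (γ s)).continuous.tendsto _).comp ((hγ t).sub (hγ s)))).norm hlen ?_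
  filter_upwards [hdist.eventually (gt_mem_nhds (sub_lt_iff_lt_add'.2 ht))] with i hi
  have hspeed := (hj i).chainLength_sub_le s t hst
  refine (norm_chainSum_sub_sub_le ((hj i).monotone hst) fun k hk hkt => ?_).trans
    (mul_le_mul_of_nonneg_left hspeed he.le)
  rw [← dist_eq_norm]
  refine (hAρ ?_).le
  have hk' := dist_le_chainLength_sub (x i) hk
  have hkt' := chainLength_mono (x i) hkt.le
  have htri := dist_triangle_left (x i k) (γ s) (x i (j i s))
  linarith

/-- The proof passes to the limit: chains which violate the claim for smaller and smaller `δ`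
converge to a Lipschitz curve in `K`, and their Riemann sums to the integral of `A` along it. -/
lemma exists_norm_sub_sub_chainSum_le_of_chainLength_le [ProperSpace E] [ProperSpace F]
    (hK : IsCompact K) (hφ : Continuous φ) (hA : Continuous A)
    (hd : ∀ x ∈ K, HasFDerivWithinAt φ (A x) K x) {η : ℝ} (hη : 0 < η) (L : ℝ) :
    ∃ δ > 0, ∀ x m, IsFineChain (thickening δ K) δ x → chainLength x m ≤ L →
      ‖φ (x m) - φ (x 0) - chainSum A x m‖ ≤ η := by
  by_contra! hcon
  let δ (n : ℕ) : ℝ := 1 / ((n : ℝ) + 1)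
  let 𝒰 : Ultrafilter ℕ := hyperfilter ℕ
  have hδ : Tendsto δ 𝒰 (𝓝 0) :=
    tendsto_one_div_add_atTop_nhds_zero_nat.mono_left Nat.hyperfilter_le_atTop
  have hδ1 (n : ℕ) : δ n ≤ 1 := (div_le_one (by positivity)).2 (by simp)
  choose x m hx hlen hbig using fun n => hcon (δ n) Nat.one_div_pos_of_nat
  choose j hj hjm hj0 hjT using fun n =>
    (hx n).exists_isUnitSpeed ((hlen n).trans_lt (lt_add_one L))
  have hxK (n i : ℕ) : x n i ∈ cthickening 1 K :=
    thickening_subset_cthickening_of_le (hδ1 n) K ((hx n).mem i)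
  obtain ⟨C, hC⟩ :=
    hK.cthickening.exists_bound_of_continuousOn (hA.continuousOn (s := cthickening 1 K))
  have hAC (n i : ℕ) : ‖A (x n i)‖ ≤ C.toNNReal := (hC _ (hxK n i)).trans C.le_coe_toNNReal
  obtain ⟨γ, hγlip, hγ⟩ := exists_lipschitzWith_tendsto (C := 1) hK.cthickening
    (fun n t => hxK n (j n t)) hδ fun n s t => by simpa using (hj n).dist_le s t
  have hSL (n : ℕ) (t : ℝ) : chainSum A (x n) (j n t) ∈ closedBall (0 : F) (C.toNNReal * L) :=
    mem_closedBall_zero_iff.2 <| (norm_chainSum_le (hAC n) _).trans <| by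
      gcongr
      exact (chainLength_mono _ (hjm n t)).trans (hlen n)
  obtain ⟨S, hSlip, hS⟩ := exists_lipschitzWith_tendsto (isCompact_closedBall _ _) hSL hδ
    fun n => (hj n).dist_chainSum_le (hAC n)
  have hγK (t : ℝ) : γ t ∈ K :=
    mem_of_tendsto_of_mem_thickening hK.isClosed hδ (fun n => (hx n).mem (j n t)) (hγ t)
  have hL : 0 ≤ L + 1 := by linarith [chainLength_nonneg (x 0) (m 0), hlen 0]
  have hFTC := comp_sub_comp_eq_of_isLittleO hφ hd hγlip hγK hSlip.continuous
    (isLittleO_of_tendsto_chainSum hA hδ hj hγ hS) hL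
  have hlim : Tendsto (fun n => ‖φ (x n (m n)) - φ (x n 0) - chainSum A (x n) (m n)‖) 𝒰 (𝓝 0) := by
    have h := ((((hφ.tendsto _).comp (hγ (L + 1))).sub ((hφ.tendsto _).comp (hγ 0))).sub
      ((hS (L + 1)).sub (hS 0))).norm
    rw [hFTC, sub_self, norm_zero] at h
    simpa only [Function.comp_def, hjT, hj0, chainSum_zero, sub_zero] using h
  exact (ge_of_tendsto' hlim fun n => (hbig n).le).not_gt hη

lemma exists_norm_sub_sub_chainSum_le [ProperSpace E] [ProperSpace F]
    (hK : IsCompact K) (hφ : Continuous φ) (hA : Continuous A)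
    (hd : ∀ x ∈ K, HasFDerivWithinAt φ (A x) K x) {η : ℝ} (hη : 0 < η) :
    ∃ δ > 0, ∀ x m, IsFineChain (thickening δ K) δ x →
      ‖φ (x m) - φ (x 0) - chainSum A x m‖ ≤ η * (1 + chainLength x m) := by
  obtain ⟨δ₀, hδ₀, hshort⟩ :=
    exists_norm_sub_sub_chainSum_le_of_chainLength_le hK hφ hA hd hη 2
  refine ⟨min δ₀ 1, lt_min hδ₀ one_pos, fun x m => ?_⟩
  induction m using Nat.strong_induction_on generalizing x with
  | _ m ih =>
    intro hx
    have hx₀ := hx.mono (thickening_mono (min_le_left _ _) K) (min_le_left _ _)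
    have hle : η ≤ η * (1 + chainLength x m) :=
      le_mul_of_one_le_right hη.le (le_add_of_nonneg_right (chainLength_nonneg x m))
    rcases le_total (chainLength x m) 1 with hm | hm
    · exact (hshort x m hx₀ (by linarith)).trans hle
    obtain ⟨k, hkm, hk1, hk2⟩ := hx.exists_chainLength_mem_Icc (min_le_right _ _) hm
    obtain ⟨l, rfl⟩ := Nat.exists_eq_add_of_le hkm
    have hk0 : k ≠ 0 := by
      rintro rfl
      simp [not_le.2 one_pos] at hk1
    have hhead := hshort x k hx₀ hk2
    have htail := ih l (by omega) (fun i => x (k + i)) (hx.drop k)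
    rw [chainSum_add, chainLength_add]
    calc ‖φ (x (k + l)) - φ (x 0) - (chainSum A x k + chainSum A (fun i => x (k + i)) l)‖
      _ = ‖(φ (x k) - φ (x 0) - chainSum A x k) +
          (φ (x (k + l)) - φ (x (k + 0)) - chainSum A (fun i => x (k + i)) l)‖ := by
          congr 1
          rw [add_zero]
          abel
      _ ≤ η * 1 + η * (1 + chainLength (fun i => x (k + i)) l) :=
          norm_add_le_of_le (by rwa [mul_one]) htail
      _ ≤ _ := by
          rw [← mul_add]
          gcongr

end FundamentalTheorem

/-! ### Approximation in Lipschitz seminorms -/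

section LipschitzApproximation

variable {X E F G : Type*} [PseudoMetricSpace X] [NormedAddCommGroup E] [NormedAddCommGroup F]
  [NormedAddCommGroup G]

/-- `g` is uniformly close to `f` on `B`, and so are the increments of `g` and `f`: a form of
`C¹` closeness that makes sense for functions which are only Lipschitz. -/
structure LipschitzCloseOn (g f : X → F) (B : Set X) (η : ℝ≥0) : Prop where
  norm_sub_le : ∀ x ∈ B, ‖g x - f x‖ ≤ η
  lipschitzOnWith : LipschitzOnWith η (g - f) B

namespace LipschitzCloseOn

variable {f g h f₁ f₂ g₁ g₂ : X → F} {B : Set X} {η η₁ η₂ : ℝ≥0}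

lemma of_eqOn (h : Set.EqOn g f B) : LipschitzCloseOn g f B η where
  norm_sub_le x hx := by simp [h hx]
  lipschitzOnWith x hx y hy := by simp [h hx, h hy]

lemma weaken (h : LipschitzCloseOn g f B η₁) (hη : η₁ ≤ η₂) : LipschitzCloseOn g f B η₂ :=
  ⟨fun x hx => (h.norm_sub_le x hx).trans hη, h.lipschitzOnWith.weaken hη⟩

lemma add (h₁ : LipschitzCloseOn g₁ f₁ B η₁) (h₂ : LipschitzCloseOn g₂ f₂ B η₂) :
    LipschitzCloseOn (g₁ + g₂) (f₁ + f₂) B (η₁ + η₂) where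
  norm_sub_le x hx := by
    rw [Pi.add_apply, Pi.add_apply, add_sub_add_comm]
    exact norm_add_le_of_le (h₁.norm_sub_le x hx) (h₂.norm_sub_le x hx)
  lipschitzOnWith := by
    rw [add_sub_add_comm]
    exact h₁.lipschitzOnWith.add h₂.lipschitzOnWith

lemma trans (h₁ : LipschitzCloseOn h g B η₁) (h₂ : LipschitzCloseOn g f B η₂) :
    LipschitzCloseOn h f B (η₁ + η₂) where
  norm_sub_le x hx := norm_sub_le_norm_sub_add_norm_sub (h x) (g x) (f x) |>.trans
    (add_le_add (h₁.norm_sub_le x hx) (h₂.norm_sub_le x hx))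
  lipschitzOnWith := by
    rw [← sub_add_sub_cancel h g f]
    exact h₁.lipschitzOnWith.add h₂.lipschitzOnWith

lemma comp {Y : Type*} [PseudoMetricSpace Y] {u : Y → X} {D : Set Y} {C : ℝ≥0}
    (h : LipschitzCloseOn g f (u '' D) η) (hu : LipschitzWith C u) :
    LipschitzCloseOn (g ∘ u) (f ∘ u) D (η * max 1 C) where
  norm_sub_le y hy := (h.norm_sub_le (u y) ⟨y, hy, rfl⟩).trans <| by
    exact_mod_cast le_mul_of_one_le_right zero_le (le_max_left 1 C)
  lipschitzOnWith := (h.lipschitzOnWith.comp hu.lipschitzOnWith (Set.mapsTo_image u D)).weaken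
    (mul_le_mul_right (le_max_right 1 C) η)

variable [NormedSpace ℝ F] [NormedSpace ℝ G]

lemma clm_comp (h : LipschitzCloseOn g f B η) (L : F →L[ℝ] G) :
    LipschitzCloseOn (fun x => L (g x)) (fun x => L (f x)) B (‖L‖₊ * η) where
  norm_sub_le x hx := by
    rw [← map_sub]
    exact L.le_opNorm_of_le (h.norm_sub_le x hx)
  lipschitzOnWith := by
    have hsub : (fun x => L (g x)) - (fun x => L (f x)) = L ∘ (g - f) :=
      funext fun x => (map_sub L (g x) (f x)).symm
    rw [hsub]
    exact L.lipschitz.comp_lipschitzOnWith h.lipschitzOnWith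

end LipschitzCloseOn

variable [NormedSpace ℝ F] [NormedSpace ℝ G]

/-- The closure of a space of functions in the topology of convergence in Lipschitz norm on
bounded sets. -/
def lipClosure (N : Submodule ℝ (X → F)) : Submodule ℝ (X → F) where
  carrier := {f | ∀ B, Bornology.IsBounded B → ∀ η > 0, ∃ g ∈ N, LipschitzCloseOn g f B η}
  zero_mem' B _ η _ := ⟨0, N.zero_mem, .of_eqOn fun _ _ => rfl⟩
  add_mem' {f₁ f₂} h₁ h₂ B hB η hη := by
    obtain ⟨g₁, hg₁, hgf₁⟩ := h₁ B hB (η / 2) (half_pos hη)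
    obtain ⟨g₂, hg₂, hgf₂⟩ := h₂ B hB (η / 2) (half_pos hη)
    exact ⟨g₁ + g₂, N.add_mem hg₁ hg₂, (hgf₁.add hgf₂).weaken (add_halves η).le⟩
  smul_mem' c {f} h B hB η hη := by
    obtain ⟨r, hr, hcr⟩ := exists_pos_mul_lt hη ‖c • ContinuousLinearMap.id ℝ F‖₊
    obtain ⟨g, hg, hgf⟩ := h B hB r hr
    exact ⟨c • g, N.smul_mem c hg, (hgf.clm_comp (c • ContinuousLinearMap.id ℝ F)).weaken hcr.le⟩

lemma lipClosure_le {N M : Submodule ℝ (X → F)} (h : N ≤ lipClosure M) :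
    lipClosure N ≤ lipClosure M := fun f hf B hB η hη => by
  obtain ⟨g, hg, hgf⟩ := hf B hB (η / 2) (half_pos hη)
  obtain ⟨k, hk, hkg⟩ := h hg B hB (η / 2) (half_pos hη)
  exact ⟨k, hk, (hkg.trans hgf).weaken (add_halves η).le⟩

lemma comp_mem_lipClosure {Y : Type*} [PseudoMetricSpace Y] {N : Submodule ℝ (X → F)}
    {M : Submodule ℝ (Y → F)} {u : Y → X} {C : ℝ≥0} (hu : LipschitzWith C u)
    (hNM : ∀ g ∈ N, g ∘ u ∈ M) {f : X → F} (hf : f ∈ lipClosure N) : f ∘ u ∈ lipClosure M := by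
  intro B hB η hη
  obtain ⟨g, hg, hgf⟩ := hf (u '' B) (hu.isBounded_image hB) (η / max 1 C)
    (div_pos hη (one_pos.trans_le (le_max_left 1 C)))
  refine ⟨g ∘ u, hNM g hg, (hgf.comp hu).weaken ?_⟩
  rw [div_mul_cancel₀ _ (one_pos.trans_le (le_max_left 1 C)).ne']

variable [NormedSpace ℝ E] {f g h : E → F} {f' : E → E →L[ℝ] F} {K : Set E} {ε η : ℝ≥0}

/-- `g` approximates the function `f` with derivative `f'` on `K`, up to `ε`, together with the
derivative: since `g` need not be differentiable, the latter means that the increments of `g` in a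
small ball around a point `x` of `K` are given by `f' x`, up to the relative error `ε`. -/
structure IsC1Approx (g f : E → F) (f' : E → E →L[ℝ] F) (K : Set E) (ε : ℝ≥0) : Prop where
  norm_sub_le : ∀ x ∈ K, ‖g x - f x‖ ≤ ε
  approximatesLinearOn : ∀ᶠ r in 𝓝[>] (0 : ℝ), ∀ x ∈ K, ApproximatesLinearOn g (f' x) (ball x r) ε

lemma eventually_approximatesLinearOn_ball {r : ℝ} (hr : 0 < r)
    (h : ∀ x ∈ K, ApproximatesLinearOn g (f' x) (ball x r) ε) :
    ∀ᶠ s in 𝓝[>] (0 : ℝ), ∀ x ∈ K, ApproximatesLinearOn g (f' x) (ball x s) ε :=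
  mem_of_superset (Ioc_mem_nhdsGT hr) fun _ hs x hx => (h x hx).mono_set (ball_subset_ball hs.2)

namespace IsC1Approx

lemma norm_fderiv_sub_le (hg : IsC1Approx g f f' K ε) {x : E} (hx : x ∈ K) {g' : E →L[ℝ] F}
    (hg' : HasFDerivAt g g' x) : ‖f' x - g'‖ ≤ ε := by
  obtain ⟨r, hr, hr0⟩ := (hg.approximatesLinearOn.and self_mem_nhdsWithin).exists
  rw [norm_sub_rev]
  exact (hg'.sub (f' x).hasFDerivAt).le_of_lipschitzOn (ball_mem_nhds x hr0)
    (ApproximatesLinearOn.approximatesLinearOn_iff_lipschitzOnWith.1 (hr x hx))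

lemma weaken (hg : IsC1Approx g f f' K ε) (hεη : ε ≤ η) : IsC1Approx g f f' K η :=
  ⟨fun x hx => (hg.norm_sub_le x hx).trans hεη, hg.approximatesLinearOn.mono fun _ hr x hx =>
    (hr x hx).mono_num hεη⟩

lemma of_lipschitzCloseOn (hg : IsC1Approx g f f' K ε) (hK : IsCompact K) {B : Set E}
    (hB : B ∈ 𝓝ˢ K) (hh : LipschitzCloseOn h g B η) : IsC1Approx h f f' K (η + ε) where
  norm_sub_le x hx := norm_sub_le_norm_sub_add_norm_sub (h x) (g x) (f x) |>.trans
    (add_le_add (hh.norm_sub_le x (subset_of_mem_nhdsSet hB hx)) (hg.norm_sub_le x hx))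
  approximatesLinearOn := by
    obtain ⟨r, hr0, hrB⟩ := (hasBasis_nhdsSet_thickening hK).mem_iff.1 hB
    filter_upwards [hg.approximatesLinearOn, Ioc_mem_nhdsGT hr0] with s hs hsr x hx
    have hball : ball x s ⊆ B :=
      ((ball_subset_ball hsr.2).trans (ball_subset_thickening hx r)).trans hrB
    rw [ApproximatesLinearOn.approximatesLinearOn_iff_lipschitzOnWith,
      ← sub_add_sub_cancel h g (f' x)]
    exact (hh.lipschitzOnWith.mono hball).add
      (ApproximatesLinearOn.approximatesLinearOn_iff_lipschitzOnWith.1 (hs x hx))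

lemma clm_comp (hg : IsC1Approx g f f' K ε) (L : F →L[ℝ] G) :
    IsC1Approx (fun x => L (g x)) (fun x => L (f x)) (fun x => L ∘L f' x) K (‖L‖₊ * ε) where
  norm_sub_le x hx := by
    rw [← map_sub]
    exact L.le_opNorm_of_le (hg.norm_sub_le x hx)
  approximatesLinearOn := hg.approximatesLinearOn.mono fun r hr x hx y hy z hz => by
    rw [ContinuousLinearMap.comp_apply, ← map_sub, ← map_sub]
    exact (L.le_opNorm_of_le (hr x hx y hy z hz)).trans_eq (mul_assoc _ _ _).symm

lemma pi {ι : Type*} [Fintype ι] {φ g : E → ι → ℝ} {φ' : E → E →L[ℝ] (ι → ℝ)}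
    (hg : ∀ i, IsC1Approx (fun x => g x i) (fun x => φ x i)
      (fun x => ContinuousLinearMap.proj i ∘L φ' x) K ε) : IsC1Approx g φ φ' K ε where
  norm_sub_le x hx :=
    (pi_norm_le_iff_of_nonneg ε.coe_nonneg).2 fun i => (hg i).norm_sub_le x hx
  approximatesLinearOn := (eventually_all.2 fun i => (hg i).approximatesLinearOn).mono
    fun r hr x hx y hy z hz => (pi_norm_le_iff_of_nonneg (by positivity)).2 fun i =>
      hr i x hx y hy z hz

end IsC1Approx
end LipschitzApproximation

/-! ### The cost function -/

section CostFunction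

universe u v

variable {E : Type*} [NormedAddCommGroup E] [NormedSpace ℝ E] {K U : Set E} {φ : E → ℝ}
  {A : E → E →L[ℝ] ℝ} {δ e c : ℝ} {y z : E}

/-- The costs of the chains in `U` with steps at most `δ` which start at `y`: the cost of a chain
is the value that `φ` has at its end point, transported back to `y` with the derivative `A`, plus a
penalty `e` per unit length. -/
def chainCosts (φ : E → ℝ) (A : E → E →L[ℝ] ℝ) (U : Set E) (δ e : ℝ) (y : E) : Set ℝ :=
  {c | ∃ x m, IsFineChain U δ x ∧ x 0 = y ∧ c = φ (x m) - chainSum A x m + e * chainLength x m}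

lemma self_mem_chainCosts (hδ : 0 ≤ δ) (hy : y ∈ U) : φ y ∈ chainCosts φ A U δ e y :=
  ⟨fun _ => y, 0, .const hy hδ, rfl, by simp⟩

lemma add_mem_chainCosts (hc : c ∈ chainCosts φ A U δ e y) (hz : z ∈ U) (hzy : dist z y ≤ δ) :
    c - A z (y - z) + e * dist z y ∈ chainCosts φ A U δ e z := by
  obtain ⟨x, m, hx, rfl, rfl⟩ := hc
  refine ⟨_, m + 1, hx.cons hz hzy, rfl, ?_⟩
  rw [chainSum_succ', chainLength_succ']
  change _ = φ (x m) - (A z (x 0 - z) + chainSum A x m) + e * (dist z (x 0) + chainLength x m)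
  ring

/-- The cost function: the least cost of a chain starting at `y`. -/
noncomputable def costFun (φ : E → ℝ) (A : E → E →L[ℝ] ℝ) (U : Set E) (δ e : ℝ) (y : E) : ℝ :=
  sInf (chainCosts φ A U δ e y)

lemma costFun_le (hδ : 0 ≤ δ) (hbdd : BddBelow (chainCosts φ A U δ e y)) (hy : y ∈ U) :
    costFun φ A U δ e y ≤ φ y :=
  csInf_le hbdd (self_mem_chainCosts hδ hy)

lemma le_costFun (hδ : 0 ≤ δ) (hy : y ∈ U) {b : ℝ} (hb : b ∈ lowerBounds (chainCosts φ A U δ e y)) :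
    b ≤ costFun φ A U δ e y :=
  le_csInf ⟨_, self_mem_chainCosts hδ hy⟩ hb

lemma costFun_le_add (hbdd : BddBelow (chainCosts φ A U δ e z)) (hz : z ∈ U) (hy : y ∈ U)
    (hzy : dist z y ≤ δ) :
    costFun φ A U δ e z ≤ costFun φ A U δ e y - A z (y - z) + e * dist z y := by
  suffices costFun φ A U δ e z + A z (y - z) - e * dist z y ≤ costFun φ A U δ e y by linarith
  refine le_costFun (dist_nonneg.trans hzy) hy fun c hc => ?_
  have hle : costFun φ A U δ e z ≤ _ := csInf_le hbdd (add_mem_chainCosts hc hz hzy)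
  linarith

lemma approximatesLinearOn_costFun {e : ℝ≥0} (hbdd : ∀ y, BddBelow (chainCosts φ A U δ e y)) {x : E}
    (hU : ball x (δ / 2) ⊆ U) (hA : ∀ y ∈ ball x (δ / 2), ‖A y - A x‖ ≤ e) :
    ApproximatesLinearOn (costFun φ A U δ e) (A x) (ball x (δ / 2)) (e + e) := by
  rw [ApproximatesLinearOn.approximatesLinearOn_iff_lipschitzOnWith]
  refine LipschitzOnWith.of_le_add_mul _ fun z hz y hy => ?_
  have hzy : dist z y ≤ δ := (dist_triangle_right z y x).trans (by
    linarith [mem_ball.1 hz, mem_ball.1 hy])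
  have hstep := costFun_le_add (hbdd z) (hU hz) (hU hy) hzy
  have hosc : (A z - A x) (z - y) ≤ e * dist z y := by
    rw [dist_eq_norm]
    exact (le_abs_self _).trans ((A z - A x).le_of_opNorm_le (hA z hz) _)
  rw [sub_apply, map_sub, map_sub] at hosc
  rw [map_sub] at hstep
  rw [Pi.sub_apply, Pi.sub_apply, NNReal.coe_add, add_mul]
  linarith

lemma exists_isC1Approx_of_continuous [ProperSpace E] (hK : IsCompact K) (hφ : Continuous φ)
    (hA : Continuous A) (hd : ∀ x ∈ K, HasFDerivWithinAt φ (A x) K x) {e : ℝ≥0} (he : 0 < e) :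
    ∃ g, IsC1Approx g φ A K (e + e) := by
  obtain ⟨δ₁, hδ₁, hchain⟩ := exists_norm_sub_sub_chainSum_le hK hφ hA hd
    (NNReal.coe_pos.2 he)
  obtain ⟨δ₂, hδ₂, hunif⟩ := Metric.uniformContinuousOn_iff_le.1
    ((hK.cthickening (r := 1)).uniformContinuousOn_of_continuous hA.continuousOn) e he
  obtain ⟨δ, hδ, hδδ₁, hδδ₂, hδ1⟩ : ∃ δ > 0, δ ≤ δ₁ ∧ δ ≤ δ₂ ∧ δ ≤ 1 :=
    ⟨min δ₁ (min δ₂ 1), by positivity, by simp, by simp, by simp⟩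
  have hlower (y : E) : φ y - e ∈ lowerBounds (chainCosts φ A (thickening δ K) δ e y) := by
    rintro _ ⟨x, m, hx, rfl, rfl⟩
    have h := neg_le_of_abs_le (hchain x m (hx.mono (thickening_mono hδδ₁ K) hδδ₁))
    linarith
  have hbdd (y : E) : BddBelow (chainCosts φ A (thickening δ K) δ e y) := ⟨_, hlower y⟩
  have hball {x : E} (hx : x ∈ K) : ball x (δ / 2) ⊆ thickening δ K :=
    (ball_subset_ball (half_le_self hδ.le)).trans (ball_subset_thickening hx δ)
  refine ⟨costFun φ A (thickening δ K) δ e, fun x hx => ?_,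
    eventually_approximatesLinearOn_ball (half_pos hδ) fun x hx =>
      approximatesLinearOn_costFun hbdd (hball hx) fun y hy => ?_⟩
  · have hxU := self_subset_thickening hδ K hx
    refine abs_sub_le_iff.2 ⟨?_, ?_⟩
    · linarith [costFun_le hδ.le (hbdd x) hxU, e.coe_nonneg, NNReal.coe_add e e]
    · linarith [le_costFun hδ.le hxU (hlower x), e.coe_nonneg, NNReal.coe_add e e]
  · have hthick := thickening_subset_cthickening_of_le hδ1 K
    rw [← dist_eq_norm]
    refine hunif y (hthick (hball hx hy)) x (hthick (self_subset_thickening hδ K hx)) ?_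
    linarith [mem_ball.1 hy]

lemma exists_continuous_eqOn {X : Type u} {Y : Type v} [TopologicalSpace X]
    [NormalSpace X] [TopologicalSpace Y] [TietzeExtension.{u, v} Y] {s : Set X}
    (hs : IsClosed s) {f : X → Y} (hf : ContinuousOn f s) : ∃ g, Continuous g ∧ Set.EqOn g f s := by
  obtain ⟨g, hg⟩ := ContinuousMap.exists_restrict_eq hs ⟨s.domRestrict f, hf.domRestrict⟩
  exact ⟨g, g.continuous, fun x hx => DFunLike.congr_fun hg ⟨x, hx⟩⟩

theorem exists_isC1Approx [FiniteDimensional ℝ E] (hK : IsCompact K) {f : E → ℝ}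
    {f' : E → E →L[ℝ] ℝ} (hf : ∀ x ∈ K, HasFDerivWithinAt f (f' x) K x) (hf' : ContinuousOn f' K)
    {ε : ℝ≥0} (hε : 0 < ε) : ∃ g, IsC1Approx g f f' K ε := by
  obtain ⟨φ, hφ, hφf⟩ := exists_continuous_eqOn hK.isClosed fun x hx =>
    (hf x hx).continuousWithinAt
  obtain ⟨A, hA, hAf⟩ := exists_continuous_eqOn hK.isClosed hf'
  have : ProperSpace E := FiniteDimensional.proper ℝ E
  obtain ⟨g, hg⟩ := exists_isC1Approx_of_continuous hK hφ hA
    (fun x hx => by rw [hAf hx]; exact (hf x hx).congr hφf (hφf hx)) (half_pos hε)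
  rw [add_halves] at hg
  refine ⟨g, fun x hx => hφf hx ▸ hg.norm_sub_le x hx, ?_⟩
  exact hg.approximatesLinearOn.mono fun r hr x hx => hAf hx ▸ hr x hx

end CostFunction

/-! ### Mollification -/

section Mollification

open scoped Convolution
open ContinuousLinearMap (lsmul)

variable {E F : Type*} [NormedAddCommGroup E]

lemma exists_lipschitzWith_hasCompactSupport_eqOn [ProperSpace E] {s : Set E} (hs : IsCompact s)
    {C : ℝ≥0} {g : E → ℝ} (hg : LipschitzOnWith C g s) :
    ∃ C' G, LipschitzWith C' G ∧ HasCompactSupport G ∧ Set.EqOn G g s := by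
  obtain ⟨R, hR⟩ := hs.isBounded.exists_norm_le
  obtain ⟨M, hM⟩ := hs.exists_bound_of_continuousOn hg.continuousOn
  obtain ⟨g₁, hg₁, heq⟩ := hg.extend_real
  -- `g₁` is truncated at `± T`, where `T` is a tent which is at least `M` on `s`.
  let T (x : E) : ℝ := max (M + R - ‖x‖) 0
  have hT : LipschitzWith (0 + 1) T :=
    ((LipschitzWith.const (M + R)).sub lipschitzWith_one_norm).max_const 0
  refine ⟨_, fun x => max (-T x) (min (g₁ x) (T x)), hT.neg.max (hg₁.min hT),
    .intro (isCompact_closedBall (0 : E) (M + R)) fun x hx => ?_, fun x hx => ?_⟩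
  · have hTx : T x = 0 := max_eq_right (by
      linarith [not_le.1 (mt mem_closedBall_zero_iff.2 hx)])
    simp [hTx]
  · have hTx : M ≤ T x := le_max_of_le_left (by linarith [hR x hx])
    have hgx := abs_le.1 ((hM x hx).trans hTx)
    change max (-T x) (min (g₁ x) (T x)) = g x
    rw [← heq hx, min_eq_left hgx.2, max_eq_right hgx.1]

variable [NormedSpace ℝ E] {K : Set E} {ε η : ℝ≥0}

lemma IsC1Approx.exists_lipschitzWith_hasCompactSupport [ProperSpace E] (hK : IsCompact K)
    {f g : E → ℝ} {f' : E → E →L[ℝ] ℝ} (hg : IsC1Approx g f f' K ε) :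
    ∃ C G, LipschitzWith C G ∧ HasCompactSupport G ∧ IsC1Approx G f f' K ε := by
  obtain ⟨r, hr, hr0⟩ := (hg.approximatesLinearOn.and self_mem_nhdsWithin).exists
  have hcpt : IsCompact (cthickening (r / 2) K) := hK.cthickening
  have hloc : LocallyLipschitzOn (cthickening (r / 2) K) g := fun y hy => by
    obtain ⟨x, hx, hyx⟩ := mem_thickening_iff.1
      (cthickening_subset_thickening' hr0 (half_lt_self hr0) K hy)
    exact ⟨_, ball x r, mem_nhdsWithin_of_mem_nhds (isOpen_ball.mem_nhds hyx),
      lipschitzOnWith_iff_restrict.2 (hr x hx).lipschitz⟩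
  obtain ⟨C, hC⟩ := hloc.exists_lipschitzOnWith_of_compact hcpt
  obtain ⟨C', G, hG, hGs, hGg⟩ := exists_lipschitzWith_hasCompactSupport_eqOn hcpt hC
  refine ⟨C', G, hG, hGs, ?_⟩
  simpa using hg.of_lipschitzCloseOn hK (cthickening_mem_nhdsSet K (half_pos hr0))
    (.of_eqOn (η := 0) hGg)

variable [FiniteDimensional ℝ E] [MeasurableSpace E] [BorelSpace E] (μ : Measure E)
  [μ.IsAddHaarMeasure] [NormedAddCommGroup F] [NormedSpace ℝ F] [CompleteSpace F]

lemma approximatesLinearOn_normed_convolution {G : E → F} (hG : Continuous G)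
    {L : E →L[ℝ] F} {x : E} {r : ℝ} {φ : ContDiffBump (0 : E)}
    (h : ApproximatesLinearOn G L (ball x (r + φ.rOut)) ε) :
    ApproximatesLinearOn (φ.normed μ ⋆[lsmul ℝ ℝ, μ] G) L (ball x r) ε := by
  intro y hy z hz
  have hconv : ConvolutionExists (φ.normed μ) G (lsmul ℝ ℝ) μ :=
    φ.hasCompactSupport_normed.convolutionExists_left _ φ.continuous_normed hG.locallyIntegrable
  have hincr : (φ.normed μ ⋆[lsmul ℝ ℝ, μ] G) y - (φ.normed μ ⋆[lsmul ℝ ℝ, μ] G) z =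
      (φ.normed μ ⋆[lsmul ℝ ℝ, μ] fun u => G (u + (y - z)) - G u) z := by
    refine (integral_sub (hconv y) (hconv z)).symm.trans
      (congrArg (integral μ) (funext fun t => ?_))
    simp only [← map_sub, sub_add_sub_cancel']
  rw [hincr, ← dist_eq_norm]
  refine dist_convolution_le (by positivity) φ.support_normed_eq.subset φ.nonneg_normed
    φ.integral_normed (by fun_prop) fun u hu => ?_
  have huz := mem_ball_iff_norm.1 hu
  have hyx := mem_ball_iff_norm.1 hy
  have hzx := mem_ball_iff_norm.1 hz
  have hmem : u ∈ ball x (r + φ.rOut) := mem_ball_iff_norm.2 <|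
    (norm_sub_le_norm_sub_add_norm_sub u z x).trans_lt (by linarith)
  have hmem' : u + (y - z) ∈ ball x (r + φ.rOut) := mem_ball_iff_norm.2 <| by
    rw [show u + (y - z) - x = (u - z) + (y - x) by abel]
    exact (norm_add_le _ _).trans_lt (by linarith)
  simpa [dist_eq_norm] using h _ hmem' _ hmem

lemma IsC1Approx.exists_normed_convolution {f G : E → F} {f' : E → E →L[ℝ] F}
    (hg : IsC1Approx G f f' K ε) (hG : UniformContinuous G) (hη : 0 < η) :
    ∃ φ : ContDiffBump (0 : E),
      IsC1Approx (φ.normed μ ⋆[lsmul ℝ ℝ, μ] G) f f' K (η + ε) := by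
  obtain ⟨δ, hδ, hunif⟩ := Metric.uniformContinuous_iff_le.1 hG η hη
  obtain ⟨r, hr, hr0⟩ := (hg.approximatesLinearOn.and self_mem_nhdsWithin).exists
  have hrδ : 0 < min (r / 2) δ := lt_min (half_pos hr0) hδ
  let φ : ContDiffBump (0 : E) := ⟨_, _, half_pos hrδ, half_lt_self hrδ⟩
  refine ⟨φ, fun x hx => ?_, eventually_approximatesLinearOn_ball (half_pos hr0) fun x hx =>
    approximatesLinearOn_normed_convolution μ hG.continuous <|
      ((hr x hx).mono_set (ball_subset_ball ?_)).mono_num le_add_self⟩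
  · refine norm_sub_le_norm_sub_add_norm_sub _ (G x) _ |>.trans
      (add_le_add ?_ (hg.norm_sub_le x hx))
    rw [← dist_eq_norm]
    exact φ.dist_normed_convolution_le hG.continuous.aestronglyMeasurable fun y hy =>
      hunif ((mem_ball.1 hy).le.trans (min_le_right _ _))
  · exact (add_le_add_right (min_le_left (r / 2) δ) _).trans_eq (add_halves r)

end Mollification

/-! ### Approximation by sums of exponential ridge functions -/

section Exponentials

open scoped InnerProductSpace Convolution Pointwise
open ContinuousLinearMap (lsmul)

lemma norm_integral_smul_le {α F : Type*} [MeasurableSpace α] {μ : Measure α}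
    [NormedAddCommGroup F] [NormedSpace ℝ F] {θ : α → ℝ} {k : α → F} {D : Set α} {κ M : ℝ}
    (hD : μ D < ∞) (hκ : 0 ≤ κ) (hθ : ∀ t ∈ D, ‖θ t‖ ≤ κ) (hk : ∀ t, ‖k t‖ ≤ M)
    (hkD : ∀ t ∉ D, k t = 0) : ‖∫ t, θ t • k t ∂μ‖ ≤ κ * M * μ.real D := by
  rw [← setIntegral_eq_integral_of_forall_compl_eq_zero fun t ht => by rw [hkD t ht, smul_zero]]
  refine norm_setIntegral_le_of_norm_le_const hD fun t ht => ?_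
  rw [norm_smul]
  exact mul_le_mul (hθ t ht) (hk t) (norm_nonneg _) hκ

lemma lipschitzCloseOn_convolution {E F : Type*} [NormedAddCommGroup E] [MeasurableSpace E]
    [BorelSpace E] {μ : Measure E} [IsLocallyFiniteMeasure μ] [NormedAddCommGroup F]
    [NormedSpace ℝ F] {B D : Set E} {θ ψ : E → ℝ} {G : E → F} {κ C : ℝ≥0} (hD : IsCompact D)
    (hψ : Continuous ψ) (hθ : Continuous θ) (hψθ : ∀ t ∈ D, ‖ψ t - θ t‖ ≤ κ)
    (hG : LipschitzWith C G) (hGs : HasCompactSupport G) (hGC : ∀ x, ‖G x‖ ≤ C)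
    (hBD : ∀ x ∈ B, ∀ t ∉ D, G (x - t) = 0) :
    LipschitzCloseOn (ψ ⋆[lsmul ℝ ℝ, μ] G) (θ ⋆[lsmul ℝ ℝ, μ] G) B
      (κ * (C * (μ D).toNNReal)) := by
  have hconv {ρ : E → ℝ} (hρ : Continuous ρ) : ConvolutionExists ρ G (lsmul ℝ ℝ) μ :=
    hGs.convolutionExists_right _ hρ.locallyIntegrable hG.continuous
  have hsub : (ψ ⋆[lsmul ℝ ℝ, μ] G) - (θ ⋆[lsmul ℝ ℝ, μ] G) = (ψ - θ) ⋆[lsmul ℝ ℝ, μ] G := by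
    rw [sub_eq_iff_eq_add, ← (hconv (hψ.sub hθ)).add_distrib (hconv hθ), sub_add_cancel]
  have hbound {M : ℝ} {k : E → F} (hk : ∀ t, ‖k t‖ ≤ M) (hkD : ∀ t ∉ D, k t = 0) :
      ‖∫ t, (ψ - θ) t • k t ∂μ‖ ≤ κ * M * μ.real D :=
    norm_integral_smul_le hD.measure_lt_top κ.coe_nonneg hψθ hk hkD
  constructor
  · intro x hx
    rw [← Pi.sub_apply, hsub]
    exact (hbound (fun t => hGC (x - t)) (hBD x hx)).trans_eq (mul_assoc _ _ _)
  · rw [hsub]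
    refine LipschitzOnWith.of_dist_le_mul fun x hx y hy => ?_
    have hincr : ((ψ - θ) ⋆[lsmul ℝ ℝ, μ] G) x - ((ψ - θ) ⋆[lsmul ℝ ℝ, μ] G) y =
        ∫ t, (ψ - θ) t • (G (x - t) - G (y - t)) ∂μ :=
      (integral_sub (hconv (hψ.sub hθ) x) (hconv (hψ.sub hθ) y)).symm.trans
        (congrArg (integral μ) (funext fun t => (smul_sub ((ψ - θ) t) _ _).symm))
    rw [dist_eq_norm, hincr]
    refine (hbound (M := C * dist x y) (fun t => ?_) fun t ht => ?_).trans_eq ?_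
    · simpa [dist_eq_norm] using hG.dist_le_mul (x - t) (y - t)
    · rw [hBD x hx t ht, hBD y hy t ht, sub_zero]
    · change _ = κ * (C * μ.real D) * dist x y
      ring

variable {E : Type*} [NormedAddCommGroup E] [InnerProductSpace ℝ E]

/-- The span of the ridge functions `x ↦ exp ⟪w, x⟫`. It is dense among the continuous functions
and, since it is stable under translations, it is also stable under convolution. -/
def expSpan (E : Type*) [NormedAddCommGroup E] [InnerProductSpace ℝ E] : Submodule ℝ (E → ℝ) :=
  Submodule.span ℝ (Set.range fun w x => Real.exp ⟪w, x⟫_ℝ)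

lemma continuous_of_mem_expSpan {ψ : E → ℝ} (hψ : ψ ∈ expSpan E) : Continuous ψ := by
  induction hψ using Submodule.span_induction with
  | mem ψ hψ =>
    obtain ⟨w, rfl⟩ := hψ
    fun_prop
  | zero => exact continuous_zero
  | add ψ₁ ψ₂ _ _ h₁ h₂ => exact h₁.add h₂
  | smul c ψ _ h => exact h.const_smul c

lemma exists_mem_expSpan_norm_sub_le {θ : E → ℝ} (hθ : Continuous θ) {D : Set E}
    (hD : IsCompact D) {κ : ℝ} (hκ : 0 < κ) : ∃ ψ ∈ expSpan E, ∀ x ∈ D, ‖ψ x - θ x‖ ≤ κ := by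
  let M : Multiplicative E →* C(E, ℝ) :=
    { toFun := fun w => ⟨fun x => Real.exp ⟪w.toAdd, x⟫_ℝ, by fun_prop⟩
      map_one' := by
        ext x
        simp
      map_mul' := fun v w => by
        ext x
        simp [inner_add_left, Real.exp_add] }
  let S : Subalgebra ℝ C(E, ℝ) := Algebra.adjoin ℝ (MonoidHom.mrange M : Set C(E, ℝ))
  have hsep : S.SeparatesPoints := fun x y hxy => by
    refine ⟨_, ⟨M (.ofAdd (x - y)), Algebra.subset_adjoin ⟨_, rfl⟩, rfl⟩, fun h => hxy ?_⟩
    have hinner : ⟪x - y, x⟫_ℝ = ⟪x - y, y⟫_ℝ := Real.exp_injective h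
    rwa [← sub_eq_zero, ← inner_sub_right, inner_self_eq_zero, sub_eq_zero] at hinner
  have hspan : Subalgebra.toSubmodule S ≤
      (expSpan E).comap (ContinuousMap.coeFnLinearMap ℝ) := by
    rw [Algebra.adjoin_eq_span, Submonoid.closure_eq, Submodule.span_le]
    rintro _ ⟨w, rfl⟩
    exact Submodule.subset_span ⟨w.toAdd, rfl⟩
  obtain ⟨ψ, hψ, hψθ⟩ :=
    ContinuousMap.exists_mem_subalgebra_near_continuous_of_isCompact_of_separatesPoints hsep
      ⟨θ, hθ⟩ hD hκ
  exact ⟨ψ, hspan hψ, fun x hx => (hψθ x hx).le⟩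

variable [MeasurableSpace E] [BorelSpace E] {μ : Measure E} [FiniteDimensional ℝ E]
  [μ.IsAddHaarMeasure] {θ ψ G : E → ℝ} {C : ℝ≥0}

lemma convolution_mem_expSpan (hψ : ψ ∈ expSpan E) (hG : Continuous G)
    (hGs : HasCompactSupport G) : ψ ⋆[lsmul ℝ ℝ, μ] G ∈ expSpan E := by
  have hconv {ρ : E → ℝ} (hρ : ρ ∈ expSpan E) : ConvolutionExists ρ G (lsmul ℝ ℝ) μ :=
    hGs.convolutionExists_right _ (continuous_of_mem_expSpan hρ).locallyIntegrable hG
  induction hψ using Submodule.span_induction with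
  | mem ψ hψ =>
    obtain ⟨w, rfl⟩ := hψ
    have hridge : (fun x => Real.exp ⟪w, x⟫_ℝ) ⋆[lsmul ℝ ℝ, μ] G =
        (∫ t, (Real.exp ⟪w, t⟫_ℝ)⁻¹ * G t ∂μ) • fun x => Real.exp ⟪w, x⟫_ℝ := by
      funext x
      rw [convolution_lsmul_swap, Pi.smul_apply, smul_eq_mul, mul_comm, ← integral_const_mul]
      simp only [inner_sub_right, Real.exp_sub, div_eq_mul_inv, mul_assoc, smul_eq_mul]
    rw [hridge]
    exact Submodule.smul_mem _ _ (Submodule.subset_span ⟨w, rfl⟩)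
  | zero =>
    rw [zero_convolution]
    exact Submodule.zero_mem _
  | add ψ₁ ψ₂ h₁ h₂ ih₁ ih₂ =>
    rw [(hconv h₁).add_distrib (hconv h₂)]
    exact Submodule.add_mem _ ih₁ ih₂
  | smul c ψ _ ih =>
    rw [smul_convolution]
    exact Submodule.smul_mem _ c ih

theorem convolution_mem_lipClosure_expSpan (hθ : Continuous θ) (hG : LipschitzWith C G)
    (hGs : HasCompactSupport G) : θ ⋆[lsmul ℝ ℝ, μ] G ∈ lipClosure (expSpan E) := by
  intro B hB η hη
  have : ProperSpace E := FiniteDimensional.proper ℝ E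
  obtain ⟨M, hM⟩ := hGs.exists_bound_of_continuous hG.continuous
  let D : Set E := closure B + -tsupport G
  have hD : IsCompact D := hB.isCompact_closure.add (IsCompact.neg hGs)
  obtain ⟨κ, hκ, hκη⟩ := exists_pos_mul_lt hη (max M.toNNReal C * (μ D).toNNReal)
  obtain ⟨ψ, hψ, hψθ⟩ := exists_mem_expSpan_norm_sub_le hθ hD (NNReal.coe_pos.2 hκ)
  refine ⟨_, convolution_mem_expSpan (μ := μ) hψ hG.continuous hGs, LipschitzCloseOn.weaken ?_
    ((mul_comm _ _).trans_le hκη.le)⟩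
  refine lipschitzCloseOn_convolution hD (continuous_of_mem_expSpan hψ) hθ hψθ
    (hG.weaken (le_max_right _ _)) hGs (fun x => (hM x).trans ?_) fun x hx t ht => ?_
  · exact (Real.le_coe_toNNReal M).trans (le_max_left _ _)
  by_contra h
  exact ht ⟨x, subset_closure hx, t - x, by simpa using subset_tsupport G h, add_sub_cancel x t⟩

end Exponentials

/-! ### Functions computed by shallow networks -/

section Networks

open scoped InnerProductSpace

variable {E F G : Type*} [NormedAddCommGroup E] [InnerProductSpace ℝ E] [NormedAddCommGroup F]
  [NormedSpace ℝ F] [NormedAddCommGroup G] [NormedSpace ℝ G] {σ τ : ℝ → ℝ}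

/-- The space of the functions `E → F` which are computed by networks with activation `σ`, for any
inner product space `E`: for `E = ℝ` it contains the activations that can be emulated with `σ`. -/
def netSpace (E F : Type*) [NormedAddCommGroup E] [InnerProductSpace ℝ E] [NormedAddCommGroup F]
    [NormedSpace ℝ F] (σ : ℝ → ℝ) : Submodule ℝ (E → F) :=
  Submodule.span ℝ (Set.range (Function.const E) ∪
    Set.range fun (p : E × ℝ × F) x => σ (⟪p.1, x⟫_ℝ + p.2.1) • p.2.2)

lemma const_mem_netSpace (c : F) : Function.const E c ∈ netSpace E F σ :=
  Submodule.subset_span (.inl ⟨c, rfl⟩)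

lemma neuron_mem_netSpace (w : E) (b : ℝ) (a : F) :
    (fun x => σ (⟪w, x⟫_ℝ + b) • a) ∈ netSpace E F σ :=
  Submodule.subset_span (.inr ⟨(w, b, a), rfl⟩)

lemma netSpace_le {N : Submodule ℝ (E → F)} (hconst : ∀ c, Function.const E c ∈ N)
    (hneuron : ∀ w b a, (fun x => σ (⟪w, x⟫_ℝ + b) • a) ∈ N) : netSpace E F σ ≤ N :=
  Submodule.span_le.2 <| Set.union_subset (Set.range_subset_iff.2 hconst) <|
    Set.range_subset_iff.2 fun p => hneuron p.1 p.2.1 p.2.2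

lemma map_mem_netSpace (L : F →ₗ[ℝ] G) {f : E → F} (hf : f ∈ netSpace E F σ) :
    (fun x => L (f x)) ∈ netSpace E G σ := by
  have hle : netSpace E F σ ≤ (netSpace E G σ).comap (L.compLeft E) :=
    netSpace_le (fun c => const_mem_netSpace (L c)) fun w b a => by
      change (fun x => L (σ (⟪w, x⟫_ℝ + b) • a)) ∈ netSpace E G σ
      simpa only [map_smul] using neuron_mem_netSpace w b (L a)
  exact hle hf

lemma comp_mem_netSpace {q : ℝ → ℝ} (hq : q ∈ netSpace ℝ ℝ σ) (w : E) (b : ℝ) :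
    (fun x => q (⟪w, x⟫_ℝ + b)) ∈ netSpace E ℝ σ := by
  have hle : netSpace ℝ ℝ σ ≤
      (netSpace E ℝ σ).comap (LinearMap.funLeft ℝ ℝ fun x => ⟪w, x⟫_ℝ + b) :=
    netSpace_le const_mem_netSpace fun v c a => by
      refine (congrArg (· ∈ netSpace E ℝ σ) (funext fun x => ?_)).mp
        (neuron_mem_netSpace (v • w) (v * b + c) a)
      simp [real_inner_smul_left, mul_add, add_assoc, mul_comm]
  exact hle hq

lemma pi_mem_netSpace {ι : Type*} [Fintype ι] {f : E → ι → ℝ}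
    (hf : ∀ i, (fun x => f x i) ∈ netSpace E ℝ σ) : f ∈ netSpace E (ι → ℝ) σ := by
  classical
  have hsum : f = ∑ i, fun x => LinearMap.single ℝ (fun _ => ℝ) i (f x i) := by
    funext x
    simp [Finset.sum_apply, Finset.univ_sum_single]
  rw [hsum]
  exact Submodule.sum_mem _ fun i _ => map_mem_netSpace _ (hf i)

lemma netSpace_mono (hσ : σ ∈ netSpace ℝ ℝ τ) : netSpace E F σ ≤ netSpace E F τ :=
  netSpace_le const_mem_netSpace fun w b a =>
    map_mem_netSpace (LinearMap.toSpanSingleton ℝ F a) (comp_mem_netSpace hσ w b)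

lemma exists_lipschitzWith_of_mem_netSpace {C : ℝ≥0} (hσ : LipschitzWith C σ) {f : E → F}
    (hf : f ∈ netSpace E F σ) : ∃ C', LipschitzWith C' f := by
  induction hf using Submodule.span_induction with
  | mem f hf =>
    obtain ⟨c, rfl⟩ | ⟨⟨w, b, a⟩, rfl⟩ := hf
    · exact ⟨0, LipschitzWith.const c⟩
    · have hinner : LipschitzWith ‖innerSL ℝ w‖₊ fun x => ⟪w, x⟫_ℝ + b :=
        LipschitzWith.of_dist_le_mul fun x y => by
          simpa using (innerSL ℝ w).lipschitz.dist_le_mul x y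
      exact ⟨_, (ContinuousLinearMap.toSpanSingleton ℝ a).lipschitz.comp (hσ.comp hinner)⟩
  | zero => exact ⟨0, LipschitzWith.const 0⟩
  | add f₁ f₂ _ _ h₁ h₂ =>
    obtain ⟨⟨C₁, h₁⟩, ⟨C₂, h₂⟩⟩ := And.intro h₁ h₂
    exact ⟨_, h₁.add h₂⟩
  | smul c f _ h =>
    obtain ⟨C, h⟩ := h
    exact ⟨_, (lipschitzWith_smul c).comp h⟩

lemma exists_eval_eq_of_mem_netSpace {d : ℕ} {f : EuclideanSpace ℝ (Fin d) → F}
    (hf : f ∈ netSpace (EuclideanSpace ℝ (Fin d)) F σ) : ∃ N : ShallowNet d F, N.eval σ = f := by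
  induction hf using Submodule.span_induction with
  | mem f hf =>
    obtain ⟨c, rfl⟩ | ⟨⟨w, b, a⟩, rfl⟩ := hf
    · exact ⟨⟨0, Fin.elim0, Fin.elim0, Fin.elim0, c⟩, by funext x; simp [ShallowNet.eval]⟩
    · exact ⟨⟨1, fun _ => w, fun _ => b, fun _ => a, 0⟩, by funext x; simp [ShallowNet.eval]⟩
  | zero => exact ⟨⟨0, Fin.elim0, Fin.elim0, Fin.elim0, 0⟩, by funext x; simp [ShallowNet.eval]⟩
  | add _ _ _ _ h₁ h₂ =>
    obtain ⟨⟨N, rfl⟩, ⟨M, rfl⟩⟩ := And.intro h₁ h₂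
    refine ⟨⟨N.width + M.width, Fin.append N.weight M.weight, Fin.append N.bias M.bias,
      Fin.append N.out M.out, N.outBias + M.outBias⟩, funext fun x => ?_⟩
    simp only [ShallowNet.eval, Fin.sum_univ_add, Fin.append_left, Fin.append_right, Pi.add_apply]
    abel
  | smul c _ _ h =>
    obtain ⟨N, rfl⟩ := h
    refine ⟨⟨N.width, N.weight, N.bias, fun i => c • N.out i, c • N.outBias⟩, funext fun x => ?_⟩
    simp only [ShallowNet.eval, Pi.smul_apply, smul_add, Finset.smul_sum, smul_comm c]

lemma leakyRelu_add_mul_leakyRelu_neg (α t : ℝ) :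
    leakyRelu α t + α * leakyRelu α (-t) = (1 - α ^ 2) * relu t := by
  rcases lt_trichotomy t 0 with ht | rfl | ht
  · rw [leakyRelu, leakyRelu, relu, if_neg ht.not_ge, if_pos (by linarith), max_eq_right ht.le]
    ring
  · simp [leakyRelu, relu]
  · rw [leakyRelu, leakyRelu, relu, if_pos ht.le, if_neg (by linarith), max_eq_left ht.le]
    ring

lemma self_mem_netSpace (σ : ℝ → ℝ) : σ ∈ netSpace ℝ ℝ σ := by
  simpa using neuron_mem_netSpace (σ := σ) (1 : ℝ) 0 (1 : ℝ)

lemma relu_mem_netSpace_leakyRelu {α : ℝ} (hα : α ^ 2 ≠ 1) :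
    relu ∈ netSpace ℝ ℝ (leakyRelu α) := by
  have hneg : (fun t => leakyRelu α (-t)) ∈ netSpace ℝ ℝ (leakyRelu α) := by
    simpa using comp_mem_netSpace (self_mem_netSpace (leakyRelu α)) (-1 : ℝ) 0
  have hrelu : relu = (1 - α ^ 2)⁻¹ • (leakyRelu α + α • fun t => leakyRelu α (-t)) := by
    funext t
    rw [Pi.smul_apply, smul_eq_mul, eq_inv_mul_iff_mul_eq₀ (sub_ne_zero.2 hα.symm)]
    exact (leakyRelu_add_mul_leakyRelu_neg α t).symm
  rw [hrelu]
  exact Submodule.smul_mem _ _ (add_mem (self_mem_netSpace _) (Submodule.smul_mem _ _ hneg))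

lemma IsReluOrLeakyRelu.relu_mem_netSpace (hσ : IsReluOrLeakyRelu σ) :
    relu ∈ netSpace ℝ ℝ σ := by
  rcases hσ with rfl | ⟨α, hα₀, hα₁, rfl⟩
  · exact self_mem_netSpace relu
  · exact relu_mem_netSpace_leakyRelu (pow_lt_one₀ hα₀.le hα₁ two_ne_zero).ne

end Networks

/-! ### Piecewise linear interpolation -/

section Interpolation

lemma lipschitzWith_relu : LipschitzWith 1 relu := LipschitzWith.id.max_const 0

lemma hasDerivWithinAt_relu_sub (c t : ℝ) :
    HasDerivWithinAt (fun s => relu (s - c)) (if c ≤ t then 1 else 0) (Set.Ici t) t := by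
  split_ifs with hct
  · refine ((hasDerivWithinAt_id t _).sub_const c).congr (fun s hs => ?_) ?_
    · exact max_eq_left (sub_nonneg.2 (hct.trans hs))
    · exact max_eq_left (sub_nonneg.2 hct)
  · have hzero : (fun s => relu (s - c)) =ᶠ[𝓝 t] fun _ => 0 :=
      (eventually_lt_nhds (not_le.1 hct)).mono fun s hs => max_eq_right (sub_nonpos.2 hs.le)
    exact ((hasDerivAt_const t (0 : ℝ)).congr_of_eventuallyEq hzero).hasDerivWithinAt

/-- The continuous piecewise linear function which vanishes up to `τ 0`, has slope `m k` between
`τ k` and `τ (k + 1)` for each `k < n`, and is constant from `τ n` on. -/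
def brokenLine (τ m : ℕ → ℝ) (n : ℕ) (t : ℝ) : ℝ :=
  ∑ i ∈ Finset.range n, m i * (relu (t - τ i) - relu (t - τ (i + 1)))

variable {τ m : ℕ → ℝ} {n : ℕ}

lemma brokenLine_mem_netSpace (τ m : ℕ → ℝ) (n : ℕ) : brokenLine τ m n ∈ netSpace ℝ ℝ relu := by
  have hrelu (c : ℝ) : (fun t => relu (t - c)) ∈ netSpace ℝ ℝ relu := by
    simpa [sub_eq_add_neg] using neuron_mem_netSpace (σ := relu) (1 : ℝ) (-c) (1 : ℝ)
  have hsum : brokenLine τ m n = ∑ i ∈ Finset.range n,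
      m i • ((fun t => relu (t - τ i)) - fun t => relu (t - τ (i + 1))) := by
    funext t
    simp [brokenLine]
  rw [hsum]
  exact Submodule.sum_mem _ fun i _ => Submodule.smul_mem _ _ (sub_mem (hrelu _) (hrelu _))

lemma continuous_brokenLine : Continuous (brokenLine τ m n) := by
  have := lipschitzWith_relu.continuous
  unfold brokenLine
  fun_prop

lemma brokenLine_left (hτ : Monotone τ) : brokenLine τ m n (τ 0) = 0 :=
  Finset.sum_eq_zero fun i _ => by
    rw [relu, relu, max_eq_right (sub_nonpos.2 (hτ i.zero_le)),
      max_eq_right (sub_nonpos.2 (hτ (i + 1).zero_le)), sub_zero, mul_zero]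

lemma hasDerivWithinAt_brokenLine (hτ : Monotone τ) {k : ℕ} (hk : k < n) {t : ℝ}
    (ht : t ∈ Set.Ico (τ k) (τ (k + 1))) :
    HasDerivWithinAt (brokenLine τ m n) (m k) (Set.Ici t) t := by
  have hderiv := HasDerivWithinAt.fun_sum fun i (_ : i ∈ Finset.range n) =>
    ((hasDerivWithinAt_relu_sub (τ i) t).sub
      (hasDerivWithinAt_relu_sub (τ (i + 1)) t)).const_mul (m i)
  refine hderiv.congr_deriv ?_
  rw [Finset.sum_eq_single_of_mem k (Finset.mem_range.2 hk), if_pos ht.1, if_neg ht.2.not_ge,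
    sub_zero, mul_one]
  rintro i - hik
  rcases hik.lt_or_gt with hik | hki
  · rw [if_pos ((hτ hik.le).trans ht.1), if_pos ((hτ hik).trans ht.1), sub_self, mul_zero]
  · have hti : t < τ i := ht.2.trans_le (hτ hki)
    rw [if_neg hti.not_ge, if_neg (hti.trans_le (hτ i.le_succ)).not_ge, sub_self, mul_zero]

lemma lipschitzOnWith_Icc_of_hasDerivWithinAt_Ici {F : Type*} [NormedAddCommGroup F]
    [NormedSpace ℝ F] {f : ℝ → F} {a b : ℝ} {C : ℝ≥0} (hf : ContinuousOn f (Set.Icc a b))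
    (hf' : ∀ t ∈ Set.Ico a b, ∃ v, HasDerivWithinAt f v (Set.Ici t) t ∧ ‖v‖ ≤ C) :
    LipschitzOnWith C f (Set.Icc a b) := by
  choose! f' hf' hbound using hf'
  refine LipschitzOnWith.of_dist_le_mul fun x hx y hy => ?_
  wlog hxy : y ≤ x generalizing x y
  · rw [dist_comm, dist_comm x]
    exact this y hy x hx (le_of_not_ge hxy)
  have hsub : Set.Ico y x ⊆ Set.Ico a b := Set.Ico_subset_Ico hy.1 hx.2
  rw [dist_eq_norm, Real.dist_eq, abs_of_nonneg (sub_nonneg.2 hxy)]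
  exact norm_image_sub_le_of_norm_deriv_right_le_segment
    (hf.mono (Set.Icc_subset_Icc hy.1 hx.2)) (fun t ht => hf' t (hsub ht))
    (fun t ht => hbound t (hsub ht)) x ⟨hxy, le_rfl⟩

lemma LipschitzCloseOn.of_lipschitzOnWith {X F : Type*} [PseudoMetricSpace X]
    [NormedAddCommGroup F] {f g : X → F} {B : Set X} {η R : ℝ≥0}
    (h : LipschitzOnWith η (g - f) B) {a : X} (ha : a ∈ B) (hfg : g a = f a)
    (hR : ∀ x ∈ B, dist x a ≤ R) : LipschitzCloseOn g f B (η * max 1 R) where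
  norm_sub_le x hx := by
    have hle := h.dist_le_mul x hx a ha
    rw [Pi.sub_apply, Pi.sub_apply, hfg, sub_self, dist_zero_right] at hle
    exact hle.trans (mul_le_mul_of_nonneg_left ((hR x hx).trans (le_max_right _ _)) η.2)
  lipschitzOnWith := h.weaken (le_mul_of_one_le_right zero_le (le_max_left 1 R))

lemma exists_brokenLine_lipschitzOnWith_sub {p p' : ℝ → ℝ} (hp : ∀ t, HasDerivAt p (p' t) t)
    (hp' : Continuous p') (a b : ℝ) {η : ℝ≥0} (hη : 0 < η) :
    ∃ τ m n, τ 0 = a ∧ Monotone τ ∧ LipschitzOnWith η (brokenLine τ m n - p) (Set.Icc a b) := by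
  obtain ⟨δ, hδ, hδη⟩ := Metric.uniformContinuousOn_iff_le.1
    (isCompact_Icc.uniformContinuousOn_of_continuous hp'.continuousOn : UniformContinuousOn p'
      (Set.Icc a b)) η hη
  let τ : ℕ → ℝ := fun i => a + i * δ
  have hτ : Monotone τ := fun i j hij => by simp only [τ]; gcongr
  have hτ_top : Tendsto τ atTop atTop :=
    tendsto_atTop_add_const_left _ a (tendsto_natCast_atTop_atTop.atTop_mul_const hδ)
  have hτ_Ici : ⋃ k, Set.Ico (τ k) (τ (k + 1)) = Set.Ici (τ 0) :=
    iUnion_Ico_map_succ_eq_Ici (fun k => hτ k.zero_le) (not_bddAbove_of_tendsto_atTop hτ_top)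
  have hτ₀ : τ 0 = a := by simp [τ]
  obtain ⟨n, hbn⟩ := (hτ_top.eventually_ge_atTop b).exists
  refine ⟨τ, p' ∘ τ, n, hτ₀, hτ, lipschitzOnWith_Icc_of_hasDerivWithinAt_Ici
    (continuous_brokenLine.sub
      (continuous_iff_continuousAt.2 fun t => (hp t).continuousAt)).continuousOn fun t ht => ?_⟩
  obtain ⟨k, hk⟩ := Set.mem_iUnion.1 (hτ_Ici.ge (hτ₀.trans_le ht.1))
  have hkn : k < n := hτ.reflect_lt (hk.1.trans_lt (ht.2.trans_le hbn))
  refine ⟨p' (τ k) - p' t, (hasDerivWithinAt_brokenLine hτ hkn hk).sub (hp t).hasDerivWithinAt, ?_⟩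
  refine hδη _ ⟨hτ₀.symm.trans_le (hτ k.zero_le), hk.1.trans ht.2.le⟩ _ ⟨ht.1, ht.2.le⟩ ?_
  rw [dist_comm, Real.dist_eq, abs_of_nonneg (sub_nonneg.2 hk.1)]
  have := hk.2
  simp only [τ] at this ⊢
  push_cast at this
  linarith

lemma mem_lipClosure_netSpace_relu {p p' : ℝ → ℝ} (hp : ∀ t, HasDerivAt p (p' t) t)
    (hp' : Continuous p') : p ∈ lipClosure (netSpace ℝ ℝ relu) := by
  intro B hB η hη
  obtain ⟨R, hR, hBR⟩ := hB.subset_closedBall_lt 0 0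
  lift R to ℝ≥0 using hR.le
  rw [Real.closedBall_eq_Icc, zero_sub, zero_add] at hBR
  have hmax : (0 : ℝ≥0) < max 1 (2 * R) := one_pos.trans_le (le_max_left _ _)
  obtain ⟨τ, m, n, hτ₀, hτ, hlip⟩ := exists_brokenLine_lipschitzOnWith_sub hp hp' (-R) R
    (div_pos hη hmax)
  let q : ℝ → ℝ := brokenLine τ m n + Function.const ℝ (p (-R))
  have hq : q (-R) = p (-R) := by simp [q, ← hτ₀, brokenLine_left hτ]
  have hlip' : LipschitzOnWith (η / max 1 (2 * R)) (q - p) (Set.Icc (-R : ℝ) R) := by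
    intro x hx y hy
    simpa [q, add_sub_right_comm, edist_add_right] using hlip hx hy
  have hclose := LipschitzCloseOn.of_lipschitzOnWith (R := 2 * R) hlip'
    (Set.left_mem_Icc.2 (by linarith)) hq fun t ht => by
      rw [Real.dist_eq, abs_of_nonneg (by linarith [ht.1])]
      push_cast
      linarith [ht.2]
  rw [div_mul_cancel₀ _ hmax.ne'] at hclose
  exact ⟨q, add_mem (brokenLine_mem_netSpace τ m n) (const_mem_netSpace _),
    fun x hx => hclose.norm_sub_le x (hBR hx), hclose.lipschitzOnWith.mono hBR⟩

open scoped InnerProductSpace in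
lemma expSpan_le_lipClosure_netSpace_relu {E : Type*} [NormedAddCommGroup E]
    [InnerProductSpace ℝ E] : expSpan E ≤ lipClosure (netSpace E ℝ relu) := by
  refine Submodule.span_le.2 (Set.range_subset_iff.2 fun w => ?_)
  refine comp_mem_lipClosure (u := fun x => ⟪w, x⟫_ℝ) (innerSL ℝ w).lipschitz
    (fun q hq => ?_) (mem_lipClosure_netSpace_relu Real.hasDerivAt_exp Real.continuous_exp)
  simpa [Function.comp_def] using comp_mem_netSpace hq w 0

end Interpolation

/-! ### Approximation by shallow networks -/

section Approximation

open scoped Convolution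
open ContinuousLinearMap (lsmul)

variable {E F : Type*} [NormedAddCommGroup E] [InnerProductSpace ℝ E] [FiniteDimensional ℝ E]
  [NormedAddCommGroup F] [NormedSpace ℝ F] {K : Set E}

lemma exists_mem_netSpace_relu_isC1Approx_real (hK : IsCompact K) {f : E → ℝ} {f' : E → E →L[ℝ] ℝ}
    (hf : ∀ x ∈ K, HasFDerivWithinAt f (f' x) K x) (hf' : ContinuousOn f' K) {ε : ℝ≥0}
    (hε : 0 < ε) : ∃ g ∈ netSpace E ℝ relu, IsC1Approx g f f' K ε := by
  borelize E
  have hε₄ : 0 < ε / 4 := div_pos hε four_pos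
  obtain ⟨g₀, hg₀⟩ := exists_isC1Approx hK hf hf' (half_pos hε)
  obtain ⟨C, G, hG, hGs, hGf⟩ := hg₀.exists_lipschitzWith_hasCompactSupport hK
  obtain ⟨φ, hφ⟩ := hGf.exists_normed_convolution Measure.addHaar hG.uniformContinuous hε₄
  have hclosure : φ.normed .addHaar ⋆[lsmul ℝ ℝ, .addHaar] G ∈ lipClosure (netSpace E ℝ relu) :=
    lipClosure_le expSpan_le_lipClosure_netSpace_relu
      (convolution_mem_lipClosure_expSpan φ.continuous_normed hG hGs)
  obtain ⟨g, hg, hgφ⟩ := hclosure (thickening 1 K) hK.isBounded.thickening (ε / 4) hε₄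
  refine ⟨g, hg, (hφ.of_lipschitzCloseOn hK (isOpen_thickening.mem_nhdsSet.2
    (self_subset_thickening one_pos K)) hgφ).weaken (le_of_eq ?_)⟩
  ring

theorem exists_mem_netSpace_relu_isC1Approx [FiniteDimensional ℝ F] (hK : IsCompact K)
    {f : E → F} {f' : E → E →L[ℝ] F} (hf : ∀ x ∈ K, HasFDerivWithinAt f (f' x) K x)
    (hf' : ContinuousOn f' K) {ε : ℝ≥0} (hε : 0 < ε) :
    ∃ g ∈ netSpace E F relu, IsC1Approx g f f' K ε := by
  let e : F ≃L[ℝ] (Fin (Module.finrank ℝ F) → ℝ) :=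
    ContinuousLinearEquiv.ofFinrankEq (Module.finrank_fin_fun ℝ).symm
  let e₁ : F →L[ℝ] (Fin (Module.finrank ℝ F) → ℝ) := e
  let e₂ : (Fin (Module.finrank ℝ F) → ℝ) →L[ℝ] F := e.symm
  obtain ⟨δ, hδ, hδε⟩ := exists_pos_mul_lt hε ‖e₂‖₊
  choose g hg hgf using fun i => exists_mem_netSpace_relu_isC1Approx_real hK
    (fun x hx => (ContinuousLinearMap.proj i ∘L e₁).hasFDerivAt.comp_hasFDerivWithinAt x (hf x hx))
    (continuousOn_const.clm_comp hf') hδ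
  have happrox : IsC1Approx (fun x i => g i x) (fun x => e₁ (f x)) (fun x => e₁ ∘L f' x) K δ :=
    .pi hgf
  refine ⟨fun x => e₂ fun i => g i x, map_mem_netSpace e₂.toLinearMap (pi_mem_netSpace hg), ?_⟩
  convert (happrox.clm_comp e₂).weaken hδε.le using 1
  · ext x; simp [e₁, e₂]
  · ext x v; simp [e₁, e₂]

end Approximation

/-! ### Sobolev distances -/

section Sobolev

lemma ennreal_rpow_le_one_add {x : ℝ≥0∞} {q : ℝ} (hq₀ : 0 ≤ q) (hq₁ : q ≤ 1) : x ^ q ≤ 1 + x := by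
  rcases le_total x 1 with hx | hx
  · exact (ENNReal.rpow_le_one hx hq₀).trans le_self_add
  · calc x ^ q ≤ x ^ (1 : ℝ) := ENNReal.rpow_le_rpow_of_exponent_le hx hq₁
      _ = x := ENNReal.rpow_one x
      _ ≤ 1 + x := le_add_self

lemma ennreal_toReal_inv_le_one {p : ℝ≥0∞} (hp : 1 ≤ p) : p.toReal⁻¹ ≤ 1 := by
  simpa using ENNReal.toReal_mono ENNReal.one_ne_top (ENNReal.inv_le_one.2 hp)

lemma eLpNorm_restrict_le_of_ae_bound {α G : Type*} [MeasurableSpace α] {μ : Measure α}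
    [NormedAddCommGroup G] {s : Set α} {h : α → G} {C : ℝ≥0} {p : ℝ≥0∞} (hp : 1 ≤ p)
    (hh : ∀ᵐ x ∂μ.restrict s, ‖h x‖ ≤ C) : eLpNorm h p (μ.restrict s) ≤ C * (1 + μ s) := by
  refine (eLpNorm_le_of_ae_nnnorm_bound hh).trans ?_
  rw [Measure.restrict_apply_univ, ENNReal.smul_def, smul_eq_mul]
  gcongr
  exact ennreal_rpow_le_one_add (inv_nonneg.2 ENNReal.toReal_nonneg) (ennreal_toReal_inv_le_one hp)

variable {d : ℕ} {F : Type*} [NormedAddCommGroup F] [NormedSpace ℝ F]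
  {K : Set (EuclideanSpace ℝ (Fin d))} {f g : EuclideanSpace ℝ (Fin d) → F}
  {f' g' : EuclideanSpace ℝ (Fin d) → EuclideanSpace ℝ (Fin d) →L[ℝ] F}

lemma sobolevDist_le_of_ae_bound {C : ℝ≥0} {p : ℝ≥0∞} (hp : 1 ≤ p)
    (h : ∀ᵐ x ∂volume.restrict K, ‖f x - g x‖ ≤ C ∧ ‖f' x - g' x‖ ≤ C) :
    sobolevDist p K f f' g g' ≤ C * (2 * (1 + volume K)) := by
  rw [mul_left_comm, two_mul]
  exact add_le_add (eLpNorm_restrict_le_of_ae_bound hp (h.mono fun _ hx => hx.1))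
    (eLpNorm_restrict_le_of_ae_bound hp (h.mono fun _ hx => hx.2))

end Sobolev

theorem theorem1_general {d : ℕ} {F : Type*} [NormedAddCommGroup F] [NormedSpace ℝ F]
    [FiniteDimensional ℝ F] {σ : ℝ → ℝ} (hσ : relu ∈ netSpace ℝ ℝ σ)
    {K : Set (EuclideanSpace ℝ (Fin d))} (hK : IsCompact K)
    {f : EuclideanSpace ℝ (Fin d) → F}
    {f' : EuclideanSpace ℝ (Fin d) → EuclideanSpace ℝ (Fin d) →L[ℝ] F}
    (hf : IsC1OnWith K f f') {ε : ℝ} (hε : 0 < ε) :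
    ∃ N : ShallowNet d F,
      (∀ᵐ x ∂(volume : Measure (EuclideanSpace ℝ (Fin d))), DifferentiableAt ℝ (N.eval σ) x) ∧
      (∀ x ∈ K, ‖f x - N.eval σ x‖ < ε) ∧
      (∀ x ∈ K, DifferentiableAt ℝ (N.eval σ) x → ‖f' x - fderiv ℝ (N.eval σ) x‖ < ε) ∧
      ∀ p : ℝ≥0∞, 1 ≤ p →
        sobolevDist p K f f' (N.eval σ) (fderiv ℝ (N.eval σ)) < ENNReal.ofReal ε := by
  have hK_top : volume K ≠ ∞ := hK.measure_lt_top.ne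
  obtain ⟨δ, hδ, hδK⟩ := ENNReal.exists_nnreal_pos_mul_lt
    (a := 2 * (1 + volume K)) (b := ENNReal.ofReal ε) (by finiteness)
    (ENNReal.ofReal_pos.2 hε).ne'
  have hδε : (δ : ℝ) < ε := by
    rw [← ENNReal.ofReal_lt_ofReal_iff hε, ENNReal.ofReal_coe_nnreal]
    refine (le_mul_of_one_le_right zero_le ?_).trans_lt hδK
    exact one_le_two.trans (le_mul_of_one_le_right zero_le le_self_add)
  obtain ⟨g, hg, hgf⟩ := exists_mem_netSpace_relu_isC1Approx hK hf.hasFDerivWithinAt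
    hf.continuousOn hδ
  obtain ⟨C, hC⟩ := exists_lipschitzWith_of_mem_netSpace lipschitzWith_relu hg
  obtain ⟨N, rfl⟩ := exists_eval_eq_of_mem_netSpace (netSpace_mono hσ hg)
  have hclose : ∀ x ∈ K, ‖f x - N.eval σ x‖ ≤ δ := fun x hx => by
    rw [norm_sub_rev]
    exact hgf.norm_sub_le x hx
  have hderiv : ∀ x ∈ K, DifferentiableAt ℝ (N.eval σ) x → ‖f' x - fderiv ℝ (N.eval σ) x‖ ≤ δ :=
    fun x hx hdiff => hgf.norm_fderiv_sub_le hx hdiff.hasFDerivAt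
  refine ⟨N, hC.ae_differentiableAt, fun x hx => (hclose x hx).trans_lt hδε,
    fun x hx hdiff => (hderiv x hx hdiff).trans_lt hδε, fun p hp => ?_⟩
  refine (sobolevDist_le_of_ae_bound hp ?_).trans_lt hδK
  filter_upwards [ae_restrict_mem hK.measurableSet, ae_restrict_of_ae hC.ae_differentiableAt]
    with x hx hdiff using ⟨hclose x hx, hderiv x hx hdiff⟩

theorem theorem1 {d : ℕ} {F : Type*} [NormedAddCommGroup F] [NormedSpace ℝ F]
    [FiniteDimensional ℝ F] (σ : ℝ → ℝ) (hσ : IsReluOrLeakyRelu σ)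
    (K : Set (EuclideanSpace ℝ (Fin d))) (hK : IsCompact K)
    (f : EuclideanSpace ℝ (Fin d) → F)
    (f' : EuclideanSpace ℝ (Fin d) → EuclideanSpace ℝ (Fin d) →L[ℝ] F)
    (hf : IsC1OnWith K f f') (ε : ℝ) (hε : 0 < ε) :
    ∃ N : ShallowNet d F,
      (∀ᵐ x ∂(volume : Measure (EuclideanSpace ℝ (Fin d))), DifferentiableAt ℝ (N.eval σ) x) ∧
      (∀ x ∈ K, ‖f x - N.eval σ x‖ < ε) ∧
      (∀ x ∈ K, DifferentiableAt ℝ (N.eval σ) x → ‖f' x - fderiv ℝ (N.eval σ) x‖ < ε) ∧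
      ∀ p : ℝ≥0∞, 1 ≤ p →
        sobolevDist p K f f' (N.eval σ) (fderiv ℝ (N.eval σ)) < ENNReal.ofReal ε :=
  theorem1_general hσ.relu_mem_netSpace hK hf hε
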